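/- **Setting.** Two teams have agents $\mathcal N^{(1)}$ ($K_1$ agents) and $\mathcal N^{(2)}$ ($K_2$ agents), $\mathcal N=\mathcal N^{(1)}\cup\mathcal N^{(2)}$. Agent $k$ has a local risk $J_k(x,y)=\mathbb E\,Q_k(x,y;\boldsymbol\xi_k)$ on $\mathbb R^{M_1}\times\mathbb R^{M_2}$. The combination matrices $A^{(t)}=(a^{(t)}_{\ell k})\in\mathbb R^{K_t\times K_t}$ ($t=1,2$) are primitive and left-stochastic (nonnegative entries, column sums $1$), with Perron vectors $(p_k)_{k\in\mathcal N^{(t)}}$: $A^{(t)}p^{(t)}=p^{(t)}$, $p_k>0$, $\sum_{k\in\mathcal N^{(t)}}p_k=1$. Put $J^{(t)}=\sum_{k\in\mathcal N^{(t)}}p_kJ_k$ and $F(z)=[\nabla_xJ^{(1)}(x,y);\nabla_yJ^{(2)}(x,y)]$ for $z=[x;y]$. The inference matrix is $C=(c_{\ell k})_{\ell,k\in\mathcal N}=\begin{bmatrix}C^{(1)}&C^{(12)}\\C^{(21)}&C^{(2)}\end{bmatrix}$. **Algorithms.** All vectors $\boldsymbol x_{k,-1},\boldsymbol y_{k,-1}$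 are $0$. For $i=0,1,\dots$, with step size $\mu>0$ and stochastic gradients $\widehat{\nabla_w J}_k$ evaluated at $(\boldsymbol x_{k,i-1},\boldsymbol y_{k,i-1})$: $$\boldsymbol x_{k,i}=\sum_{\ell\in\mathcal N^{(1)}}a^{(1)}_{\ell k}\big(\boldsymbol x_{\ell,i-1}-\mu\widehat{\nabla_xJ}_\ell\big)\ (k\in\mathcal N^{(1)}),\qquad \boldsymbol y_{k,i}=\sum_{\ell\in\mathcal N^{(2)}}a^{(2)}_{\ell k}\big(\boldsymbol y_{\ell,i-1}-\mu\widehat{\nabla_yJ}_\ell\big)\ (k\in\mathcal N^{(2)}).$$ In ATC-ITC, the estimates of the opponents' strategies are $$\boldsymbol y_{k,i}=\sum_{\ell\in\mathcal N^{(2)}}c_{\ell k}\boldsymbol y_{\ell,i}+\sum_{\ell\in\mathcal N^{(1)}}c_{\ell k}\big(\boldsymbol y_{\ell,i-1}+\mu\widehat{\nabla_yJ}_\ell\big)\ (k\in\mathcal N^{(1)}),$$ $$\boldsymbol x_{k,i}=\sum_{\ell\in\mathcal N^{(1)}}c_{\ell k}\boldsymbol x_{\ell,i}+\sum_{\ell\in\mathcal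 N^{(2)}}c_{\ell k}\big(\boldsymbol x_{\ell,i-1}+\mu\widehat{\nabla_xJ}_\ell\big)\ (k\in\mathcal N^{(2)}).$$ In ATC-C, they are $\boldsymbol y_{k,i}=\sum_{\ell\in\mathcal N^{(2)}}c_{\ell k}\boldsymbol y_{\ell,i}$ ($k\in\mathcal N^{(1)}$) and $\boldsymbol x_{k,i}=\sum_{\ell\in\mathcal N^{(1)}}c_{\ell k}\boldsymbol x_{\ell,i}$ ($k\in\mathcal N^{(2)}$). **Assumptions.** (i) The $J_k$ are differentiable in $x$ and in $y$, and for $w\in\{x,y\}$ and all $k$: $\|\nabla_wJ_k(x_1,y_1)-\nabla_wJ_k(x_2,y_2)\|\le L_f(\|x_1-x_2\|+\|y_1-y_2\|)$. (ii) $\|\nabla_wJ_k(x,y)-\nabla_wJ^{(t)}(x,y)\|\le G$ for all $k\in\mathcal N^{(t)}$, $w\in\{x,y\}$, and all $x,y$. (iii) With $\boldsymbol{\mathcal F}_i$ generated by $\boldsymbol x_{k,j},\boldsymbol y_{k,j}$ ($k\in\mathcal N$, $-1\le j\le i$), at all $\boldsymbol{\mathcal F}_i$-measurable points $(\boldsymbol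 x,\boldsymbol y)$ the stochastic gradients used in iteration $i+1$ have an error $\widehat{\nabla_wJ}_k(\boldsymbol x,\boldsymbol y)-\nabla_wJ_k(\boldsymbol x,\boldsymbol y)$ with conditional mean $0$ and conditional second moment at most $\sigma^2$ given $\boldsymbol{\mathcal F}_i$. (iv) One of the following two cases holds: * *ATC-ITC*: $J^{(1)}=-J^{(2)}$; $C$ is left-stochastic; $C^{(1)},C^{(2)}$ are irreducible; and there are links $c_{\ell k}>0$ with $\ell\in\mathcal N^{(2)},k\in\mathcal N^{(1)}$ and with $\ell\in\mathcal N^{(1)},k\in\mathcal N^{(2)}$. * *ATC-C*: $C^{(1)}=0$, $C^{(2)}=0$, and $C^{(12)},C^{(21)}$ are left-stochastic. **Claim.** There are $\alpha\in(0,1)$ (for ATC-ITC) and $\beta\in(0,1)$ (for ATC-C), depending only on $A^{(1)},A^{(2)},C$, and $\mu_0>0$, depending only on these matrices and $L_f,G,\sigma$, such that for every $c>0$ there is a constant $B$, depending only on the matrices, $L_f,G,\sigma$ and $c$, with the following property. For every $\mu\in(0,\mu_0)$ the centroid $\boldsymbol z_{c,i}=\big[\sum_{k\in\mathcal N^{(1)}}p_k\boldsymbol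 x_{k,i};\ \sum_{k\in\mathcal N^{(2)}}p_k\boldsymbol y_{k,i}\big]$ satisfies $$\boldsymbol z_{c,i}=\boldsymbol z_{c,i-1}-\mu F(\boldsymbol z_{c,i-1})+\boldsymbol d_{c,i}\qquad(i\ge0),$$ where $\mathbb E\|\boldsymbol d_{c,i}\|^2\le B\mu^2$ for all $i\ge i_\alpha=\log(c\mu^2)/\log\alpha$ in the case of ATC-ITC, and for all $i\ge i_\beta=\log(c\mu^2)/\log\beta$ in the case of ATC-C. -/

import Mathlib

open MeasureTheory

namespace CompetingNetworks

noncomputable section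

/-- The Euclidean strategy space `ℝ^M`. -/
abbrev Vec (M : ℕ) := EuclideanSpace ℝ (Fin M)

/-- All agents: `Sum.inl k` is an agent of Team 1, `Sum.inr k` an agent of Team 2. -/
abbrev Agent (K₁ K₂ : ℕ) := Fin K₁ ⊕ Fin K₂

/-- The local vectors `(x_k, y_k)` of all agents: `s.1 k` is the `x`-vector and `s.2 k` the
`y`-vector held by agent `k` (its own strategy or its estimate of the opponents' strategy). -/
abbrev Profile (K₁ K₂ M₁ M₂ : ℕ) := (Agent K₁ K₂ → Vec M₁) × (Agent K₁ K₂ → Vec M₂)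

/-! ### Combination and inference matrices -/

/-- Left-stochastic: entrywise nonnegative with all column sums equal to one. -/
def LeftStochastic {m n : Type*} [Fintype m] (A : Matrix m n ℝ) : Prop :=
  (∀ l k, 0 ≤ A l k) ∧ ∀ k, ∑ l, A l k = 1

/-- The within-team combination matrix is primitive and left-stochastic. -/
def WithinTeam {K : ℕ} (A : Matrix (Fin K) (Fin K) ℝ) : Prop :=
  A.IsPrimitive ∧ LeftStochastic A

/-- `p` is the Perron eigenvector of `A`: `A p = p`, with positive entries adding up to one. -/
def IsPerronVector {K : ℕ} (A : Matrix (Fin K) (Fin K) ℝ) (p : Fin K → ℝ) : Prop :=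
  A.mulVec p = p ∧ (∀ k, 0 < p k) ∧ ∑ k, p k = 1

/-- Inference matrix of a strong cross-team subgraph: the diagonal blocks vanish and the
off-diagonal blocks are left-stochastic. -/
def StrongCross {K₁ K₂ : ℕ} (C : Matrix (Agent K₁ K₂) (Agent K₁ K₂) ℝ) : Prop :=
  C.toBlocks₁₁ = 0 ∧ C.toBlocks₂₂ = 0 ∧ LeftStochastic C.toBlocks₁₂ ∧ LeftStochastic C.toBlocks₂₁

/-- Inference matrix of a weak cross-team subgraph: left-stochastic, with irreducible diagonal
blocks, and with at least one link from each team to the other one. -/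
def WeakCross {K₁ K₂ : ℕ} (C : Matrix (Agent K₁ K₂) (Agent K₁ K₂) ℝ) : Prop :=
  LeftStochastic C ∧ C.toBlocks₁₁.IsIrreducible ∧ C.toBlocks₂₂.IsIrreducible ∧
    (∃ (k : Fin K₁) (l : Fin K₂), 0 < C (Sum.inr l) (Sum.inl k)) ∧
    (∃ (k : Fin K₂) (l : Fin K₁), 0 < C (Sum.inl l) (Sum.inr k))

/-! ### The game -/

/-- The data of a stochastic two-team game: every agent `k` has a random sample with distribution
`law k` and a loss `Q_k(x, y; ξ_k)` with finite expectation. -/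
structure StochasticGame (K₁ K₂ M₁ M₂ : ℕ) where
  Sample : Agent K₁ K₂ → Type*
  [measSample : ∀ k, MeasurableSpace (Sample k)]
  law : ∀ k, Measure (Sample k)
  isProb : ∀ k, IsProbabilityMeasure (law k)
  loss : ∀ k, Vec M₁ → Vec M₂ → Sample k → ℝ
  integrable_loss : ∀ k x y, Integrable (loss k x y) (law k)

attribute [instance] StochasticGame.measSample

/-- Partial gradient with respect to the first argument. -/
def gradX {M₁ M₂ : ℕ} (f : Vec M₁ → Vec M₂ → ℝ) (x : Vec M₁) (y : Vec M₂) : Vec M₁ :=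
  gradient (fun x' => f x' y) x

/-- Partial gradient with respect to the second argument. -/
def gradY {M₁ M₂ : ℕ} (f : Vec M₁ → Vec M₂ → ℝ) (x : Vec M₁) (y : Vec M₂) : Vec M₂ :=
  gradient (fun y' => f x y') y

namespace StochasticGame

variable {K₁ K₂ M₁ M₂ : ℕ}

/-- Local risk `J_k(x, y) = 𝔼 Q_k(x, y; ξ_k)`. -/
def risk (g : StochasticGame K₁ K₂ M₁ M₂) (k : Agent K₁ K₂) (x : Vec M₁) (y : Vec M₂) : ℝ :=
  ∫ ξ, g.loss k x y ξ ∂(g.law k)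

/-- Global risk of Team 1. -/
def risk₁ (g : StochasticGame K₁ K₂ M₁ M₂) (p₁ : Fin K₁ → ℝ) (x : Vec M₁) (y : Vec M₂) : ℝ :=
  ∑ k, p₁ k * g.risk (Sum.inl k) x y

/-- Global risk of Team 2. -/
def risk₂ (g : StochasticGame K₁ K₂ M₁ M₂) (p₂ : Fin K₂ → ℝ) (x : Vec M₁) (y : Vec M₂) : ℝ :=
  ∑ k, p₂ k * g.risk (Sum.inr k) x y

/-- Zero-sum objectives. -/
def ZeroSum (g : StochasticGame K₁ K₂ M₁ M₂) (p₁ : Fin K₁ → ℝ) (p₂ : Fin K₂ → ℝ) : Prop :=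
  ∀ x y, g.risk₁ p₁ x y = -g.risk₂ p₂ x y

/-- The gradient map `F(z) = [∇ₓ J⁽¹⁾(x, y); ∇_y J⁽²⁾(x, y)]` for `z = [x; y]`, on `ℝ^(M₁+M₂)` seen
as the Euclidean product `ℝ^M₁ × ℝ^M₂`. -/
def gradMap (g : StochasticGame K₁ K₂ M₁ M₂) (p₁ : Fin K₁ → ℝ) (p₂ : Fin K₂ → ℝ)
    (z : WithLp 2 (Vec M₁ × Vec M₂)) : WithLp 2 (Vec M₁ × Vec M₂) :=
  WithLp.toLp 2 (gradX (g.risk₁ p₁) z.fst z.snd, gradY (g.risk₂ p₂) z.fst z.snd)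

/-- The local risks are differentiable in `x` and in `y`, and their partial gradients are
`L`-Lipschitz. -/
def LipschitzGradients (g : StochasticGame K₁ K₂ M₁ M₂) (L : ℝ) : Prop :=
  ∀ k,
    (∀ x y, DifferentiableAt ℝ (fun x' => g.risk k x' y) x ∧
      DifferentiableAt ℝ (fun y' => g.risk k x y') y) ∧
    ∀ x₁ x₂ y₁ y₂,
      ‖gradX (g.risk k) x₁ y₁ - gradX (g.risk k) x₂ y₂‖ ≤ L * (‖x₁ - x₂‖ + ‖y₁ - y₂‖) ∧
      ‖gradY (g.risk k) x₁ y₁ - gradY (g.risk k) x₂ y₂‖ ≤ L * (‖x₁ - x₂‖ + ‖y₁ - y₂‖)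

/-- The disagreement between the local gradients and those of the team's global risk is at most
`G`. -/
def BoundedDisagreement (g : StochasticGame K₁ K₂ M₁ M₂) (p₁ : Fin K₁ → ℝ) (p₂ : Fin K₂ → ℝ)
    (G : ℝ) : Prop :=
  (∀ (k : Fin K₁) x y,
    ‖gradX (g.risk (Sum.inl k)) x y - gradX (g.risk₁ p₁) x y‖ ≤ G ∧
    ‖gradY (g.risk (Sum.inl k)) x y - gradY (g.risk₁ p₁) x y‖ ≤ G) ∧
  (∀ (k : Fin K₂) x y,
    ‖gradX (g.risk (Sum.inr k)) x y - gradX (g.risk₂ p₂) x y‖ ≤ G ∧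
    ‖gradY (g.risk (Sum.inr k)) x y - gradY (g.risk₂ p₂) x y‖ ≤ G)

end StochasticGame

/-! ### Stochastic gradients and the two algorithms

Times are shifted by one: index `0` is the initialization and index `i + 1` holds the iterates
computed in the iteration numbered `i` (iterations are numbered from `0`). -/

/-- Stochastic gradients: `gx i k x y ω` and `gy i k x y ω` are the stochastic approximations of the
partial gradients of `J_k` at `(x, y)` that agent `k` has at hand in iteration `i`. They are
measurable random fields. -/
structure StochasticGradient (K₁ K₂ M₁ M₂ : ℕ) (Ω : Type*) [MeasurableSpace Ω] where
  gx : ℕ → Agent K₁ K₂ → Vec M₁ → Vec M₂ → Ω → Vec M₁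
  gy : ℕ → Agent K₁ K₂ → Vec M₁ → Vec M₂ → Ω → Vec M₂
  measurable_gx : ∀ i k, Measurable fun q : (Vec M₁ × Vec M₂) × Ω => gx i k q.1.1 q.1.2 q.2
  measurable_gy : ∀ i k, Measurable fun q : (Vec M₁ × Vec M₂) × Ω => gy i k q.1.1 q.1.2 q.2

section Algorithms

variable {K₁ K₂ M₁ M₂ : ℕ}

/-- Within-team adapt-then-combine step of Team 1; `dx k` is the stochastic `x`-gradient of
agent `k`. -/
def adaptCombine₁ (A₁ : Matrix (Fin K₁) (Fin K₁) ℝ) (μ : ℝ) (dx : Agent K₁ K₂ → Vec M₁)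
    (s : Profile K₁ K₂ M₁ M₂) (k : Fin K₁) : Vec M₁ :=
  ∑ l, A₁ l k • (s.1 (Sum.inl l) - μ • dx (Sum.inl l))

/-- Within-team adapt-then-combine step of Team 2; `dy k` is the stochastic `y`-gradient of
agent `k`. -/
def adaptCombine₂ (A₂ : Matrix (Fin K₂) (Fin K₂) ℝ) (μ : ℝ) (dy : Agent K₁ K₂ → Vec M₂)
    (s : Profile K₁ K₂ M₁ M₂) (k : Fin K₂) : Vec M₂ :=
  ∑ l, A₂ l k • (s.2 (Sum.inr l) - μ • dy (Sum.inr l))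

/-- One iteration of ATC-ITC (adapt-then-combine and infer-then-combine): Team 1 infers `y` by
`ψ_k = y_k + μ ∇̂_y J_k`, Team 2 infers `x` by `ψ_k = x_k + μ ∇̂_x J_k`, and these are combined
with the new strategies received from the opponents. -/
def stepITC (A₁ : Matrix (Fin K₁) (Fin K₁) ℝ) (A₂ : Matrix (Fin K₂) (Fin K₂) ℝ)
    (C : Matrix (Agent K₁ K₂) (Agent K₁ K₂) ℝ) (μ : ℝ)
    (dx : Agent K₁ K₂ → Vec M₁) (dy : Agent K₁ K₂ → Vec M₂) (s : Profile K₁ K₂ M₁ M₂) :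
    Profile K₁ K₂ M₁ M₂ :=
  let newX := adaptCombine₁ A₁ μ dx s
  let newY := adaptCombine₂ A₂ μ dy s
  (Sum.elim newX fun k =>
      ∑ l, C (Sum.inl l) (Sum.inr k) • newX l +
        ∑ l, C (Sum.inr l) (Sum.inr k) • (s.1 (Sum.inr l) + μ • dx (Sum.inr l)),
    Sum.elim (fun k =>
      ∑ l, C (Sum.inr l) (Sum.inl k) • newY l +
        ∑ l, C (Sum.inl l) (Sum.inl k) • (s.2 (Sum.inl l) + μ • dy (Sum.inl l))) newY)

/-- One iteration of ATC-C (adapt-then-combine and combine): the opponents' new strategies are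
combined directly. -/
def stepC (A₁ : Matrix (Fin K₁) (Fin K₁) ℝ) (A₂ : Matrix (Fin K₂) (Fin K₂) ℝ)
    (C : Matrix (Agent K₁ K₂) (Agent K₁ K₂) ℝ) (μ : ℝ)
    (dx : Agent K₁ K₂ → Vec M₁) (dy : Agent K₁ K₂ → Vec M₂) (s : Profile K₁ K₂ M₁ M₂) :
    Profile K₁ K₂ M₁ M₂ :=
  let newX := adaptCombine₁ A₁ μ dx s
  let newY := adaptCombine₂ A₂ μ dy s
  (Sum.elim newX fun k => ∑ l, C (Sum.inl l) (Sum.inr k) • newX l,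
    Sum.elim (fun k => ∑ l, C (Sum.inr l) (Sum.inl k) • newY l) newY)

variable {Ω : Type*} [MeasurableSpace Ω]

/-- The iterates produced from the zero initialization by an algorithm with the given step, where
every agent evaluates its stochastic gradients at its current pair of vectors. -/
def iterates
    (step : (Agent K₁ K₂ → Vec M₁) → (Agent K₁ K₂ → Vec M₂) →
      Profile K₁ K₂ M₁ M₂ → Profile K₁ K₂ M₁ M₂)
    (O : StochasticGradient K₁ K₂ M₁ M₂ Ω) : ℕ → Ω → Profile K₁ K₂ M₁ M₂
  | 0, _ => 0
  | i + 1, ω =>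
      let s := iterates step O i ω
      step (fun k => O.gx i k (s.1 k) (s.2 k) ω) (fun k => O.gy i k (s.1 k) (s.2 k) ω) s

/-- The σ-algebra generated by the vectors of all agents up to time `i`. -/
abbrev history (s : ℕ → Ω → Profile K₁ K₂ M₁ M₂) (i : ℕ) : MeasurableSpace Ω :=
  ⨆ j ≤ i, ⨆ k : Agent K₁ K₂,
    MeasurableSpace.comap (fun ω => (s j ω).1 k) inferInstance ⊔
      MeasurableSpace.comap (fun ω => (s j ω).2 k) inferInstance

/-- Gradient noise along a process `s`: at all points that are measurable with respect to the
history, the error of the stochastic gradients of the next iteration has conditional mean zero and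
conditional second moment at most `σ ^ 2`. -/
def GradientNoise (P : Measure Ω) (g : StochasticGame K₁ K₂ M₁ M₂)
    (O : StochasticGradient K₁ K₂ M₁ M₂ Ω) (s : ℕ → Ω → Profile K₁ K₂ M₁ M₂) (σ : ℝ) : Prop :=
  ∀ (i : ℕ) (k : Agent K₁ K₂) (X : Ω → Vec M₁) (Y : Ω → Vec M₂),
    Measurable[history s i] X → Measurable[history s i] Y →
    let errX := fun ω => O.gx i k (X ω) (Y ω) ω - gradX (g.risk k) (X ω) (Y ω)
    let errY := fun ω => O.gy i k (X ω) (Y ω) ω - gradY (g.risk k) (X ω) (Y ω)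
    (Integrable (fun ω => ‖errX ω‖ ^ 2) P ∧ P[errX | history s i] =ᵐ[P] 0 ∧
      P[fun ω => ‖errX ω‖ ^ 2 | history s i] ≤ᵐ[P] fun _ => σ ^ 2) ∧
    (Integrable (fun ω => ‖errY ω‖ ^ 2) P ∧ P[errY | history s i] =ᵐ[P] 0 ∧
      P[fun ω => ‖errY ω‖ ^ 2 | history s i] ≤ᵐ[P] fun _ => σ ^ 2)

/-- The network centroid `z_c = [∑ p_k x_k (Team 1); ∑ p_k y_k (Team 2)]`. -/
def centroid (p₁ : Fin K₁ → ℝ) (p₂ : Fin K₂ → ℝ) (s : Profile K₁ K₂ M₁ M₂) :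
    WithLp 2 (Vec M₁ × Vec M₂) :=
  WithLp.toLp 2 (∑ k, p₁ k • s.1 (Sum.inl k), ∑ k, p₂ k • s.2 (Sum.inr k))

/-- Perturbed gradient play of the centroid of the process `s`: `d i` is the perturbation in
iteration `i`, and `𝔼‖d i‖² ≤ B` (with finite expectation) for all iterations `i ≥ i₀`. -/
def PerturbedGradientPlay (P : Measure Ω) (g : StochasticGame K₁ K₂ M₁ M₂)
    (p₁ : Fin K₁ → ℝ) (p₂ : Fin K₂ → ℝ) (s : ℕ → Ω → Profile K₁ K₂ M₁ M₂) (μ i₀ B : ℝ) : Prop :=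
  ∃ d : ℕ → Ω → WithLp 2 (Vec M₁ × Vec M₂),
    (∀ i ω, centroid p₁ p₂ (s (i + 1) ω) =
      centroid p₁ p₂ (s i ω) - μ • g.gradMap p₁ p₂ (centroid p₁ p₂ (s i ω)) + d i ω) ∧
    ∀ i : ℕ, i₀ ≤ (i : ℝ) →
      Integrable (fun ω => ‖d i ω‖ ^ 2) P ∧ ∫ ω, ‖d i ω‖ ^ 2 ∂P ≤ B

end Algorithms

end

end CompetingNetworks

namespace CompetingNetworks

/-! ### Left-stochastic matrices and minorization -/

section Stochastic

variable {m n ι κ : Type*}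

/-! The `x`-vectors of all agents, strategies and estimates alike, perform a single diffusion `x ↦
combine T (x - μ v)` with `T = [[A₁, A₁ C₁₂], [0, C₂₂]]`; the `y`-vectors do the same with the teams
exchanged. The direction `v` is the stochastic gradient on Team 1. On Team 2 the inference step `+μ
∇̂ₓJ_k` is a descent step along `-∇̂ₓJ_k`, which in a zero-sum game approximates `∇ₓJ⁽¹⁾`. If `C₂₂ =
0` instead, the directions of Team 2 are multiplied by zero and may be chosen at will
(`exists_diffusion_fst`, `exists_diffusion_snd`).

The matrix `T` is left-stochastic with invariant vector `(p₁, 0)`, so the diffusion moves the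
weighted mean, which is the centroid, by exactly `-μ` times the weighted mean of `v`. Every
estimating agent is reached from the strategy team, hence some power of `T` dominates a multiple of
the rank one limit (`mixing_fromBlocks`). Doeblin's argument then makes `T ^ N` a contraction on
vectors of weighted mean zero, and the adapted norm `mixNorm` turns this into a contraction by `γ <
1` in each step.

Let `D` be the total disagreement, `e` the sum of the noise norms and `L`, `G` nonnegative. All
directions are within `e + G + L D` of the gradient at the centroid, so one step gives `D' ≤ (γ + μ
K L) D + μ K (e + G)` and a perturbation of norm at most `2 μ (e + G + L D)`
(`disagreement_stepITC_le`). For small `μ` the recursion contracts. Since `D` starts at zero, its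
second moment is bounded uniformly in time (`exists_integrable_sq_le`); as the perturbation already
carries a factor `μ`, this yields `O(μ²)` from the first iteration on, whatever the threshold. -/

theorem LeftStochastic.mul [Fintype m] [Fintype n] {A : Matrix m n ℝ} {B : Matrix n ι ℝ} (hA : LeftStochastic A)
    (hB : LeftStochastic B) : LeftStochastic (A * B) := by
  refine ⟨fun l k => Finset.sum_nonneg fun j _ => mul_nonneg (hA.1 l j) (hB.1 j k), fun k => ?_⟩
  simp only [Matrix.mul_apply]
  rw [Finset.sum_comm]
  simp only [← Finset.sum_mul, hA.2, one_mul, hB.2]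

theorem leftStochastic_one [Fintype m] [DecidableEq m] : LeftStochastic (1 : Matrix m m ℝ) := by
  refine ⟨fun l k => ?_, fun k => ?_⟩
  · rw [Matrix.one_apply]; split_ifs <;> norm_num
  · simp [Matrix.one_apply]

theorem LeftStochastic.pow [Fintype m] [DecidableEq m] {A : Matrix m m ℝ} (hA : LeftStochastic A) (r : ℕ) :
    LeftStochastic (A ^ r) := by
  induction r with
  | zero => simpa using leftStochastic_one
  | succ r ih => rw [pow_succ]; exact ih.mul hA

theorem LeftStochastic.exists_pos [Fintype m] {A : Matrix m n ℝ} (hA : LeftStochastic A) (k : n) :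
    ∃ l, 0 < A l k := by
  by_contra! h
  have h1 : ∑ l, A l k ≤ 0 := Finset.sum_nonpos fun l _ => h l
  rw [hA.2 k] at h1
  linarith

theorem mul_apply_pos [Fintype n] {A : Matrix m n ℝ} {B : Matrix n ι ℝ} (hA : ∀ i j, 0 ≤ A i j)
    (hB : ∀ i j, 0 ≤ B i j) {i : m} {j : n} {k : ι} (hij : 0 < A i j) (hjk : 0 < B j k) :
    0 < (A * B) i k := by
  rw [Matrix.mul_apply]
  exact Finset.sum_pos' (fun x _ => mul_nonneg (hA i x) (hB x k))
    ⟨j, Finset.mem_univ j, mul_pos hij hjk⟩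

/-- Powers of a primitive left-stochastic matrix are eventually positive. -/
theorem LeftStochastic.exists_forall_ge_pow_pos [Fintype m] [DecidableEq m] {A : Matrix m m ℝ}
    (hA : LeftStochastic A) (hprim : A.IsPrimitive) :
    ∃ r > 0, ∀ t ≥ r, ∀ i j, 0 < (A ^ t) i j := by
  obtain ⟨r, hr, hpos⟩ := hprim.exists_pos_pow
  refine ⟨r, hr, fun t ht => ?_⟩
  induction t, ht using Nat.le_induction with
  | base => exact hpos
  | succ t ht ih =>
    intro i j
    -- Column `j` of `A` has a positive entry, so positivity of all entries of `A ^ t` passes to `A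
    -- ^ (t + 1)`.
    obtain ⟨l, hl⟩ := hA.exists_pos j
    rw [pow_succ]
    exact mul_apply_pos (hA.pow t).1 hA.1 (ih i l) hl

/-- Supplies the minorization constant. The cap `1 / 2` later keeps the contraction factor `1 - ε /
N` positive. -/
theorem exists_pos_le_of_forall_pos {α : Type*} [Finite α] (f : α → ℝ) (hf : ∀ a, 0 < f a) :
    ∃ ε, 0 < ε ∧ ε ≤ 1 / 2 ∧ ∀ a, ε ≤ f a := by
  rcases isEmpty_or_nonempty α with h | h
  · exact ⟨1 / 2, by norm_num, le_rfl, fun a => h.elim a⟩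
  · obtain ⟨a₀, ha₀⟩ := Finite.exists_min f
    exact ⟨min (1 / 2) (f a₀), lt_min (by norm_num) (hf a₀), min_le_left _ _,
      fun a => (min_le_right _ _).trans (ha₀ a)⟩

/-- A left-stochastic matrix `T` with invariant probability vector `w`, some power of which
dominates a positive multiple of the rank one matrix `w 1ᵀ`. -/
structure Mixing [Fintype ι] [DecidableEq ι] (T : Matrix ι ι ℝ) (w : ι → ℝ) : Prop where
  stochastic : LeftStochastic T
  invariant : T.mulVec w = w
  nonneg : ∀ k, 0 ≤ w k
  sum_eq_one : ∑ k, w k = 1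
  minorized : ∃ N : ℕ, 0 < N ∧ ∃ ε : ℝ, 0 < ε ∧ ε ≤ 1 / 2 ∧ ∀ l k, ε * w l ≤ (T ^ N) l k

/-- The block form puts the team whose strategies are tracked first. For Team 2 this is the reverse
of the order in `Agent`. -/
theorem Mixing.reindex [Fintype ι] [Fintype κ] [DecidableEq ι] [DecidableEq κ] {T : Matrix ι ι ℝ} {w : ι → ℝ}
    (h : Mixing T w) (e : ι ≃ κ) : Mixing (Matrix.reindex e e T) (w ∘ e.symm) where
  stochastic := ⟨fun l k => h.stochastic.1 _ _, fun k => by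
    rw [← h.stochastic.2 (e.symm k)]
    exact Equiv.sum_comp e.symm fun l => T l (e.symm k)⟩
  invariant := by
    ext k
    have := congrFun h.invariant (e.symm k)
    rw [Function.comp_apply, ← this]
    exact Equiv.sum_comp e.symm fun l => T (e.symm k) l * w l
  nonneg k := h.nonneg _
  sum_eq_one := by rw [← h.sum_eq_one]; exact Equiv.sum_comp e.symm w
  minorized := by
    obtain ⟨N, hN, ε, h0, h1, hε⟩ := h.minorized
    refine ⟨N, hN, ε, h0, h1, fun l k => ?_⟩
    have : Matrix.reindex e e T ^ N = Matrix.reindex e e (T ^ N) := by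
      simpa using (map_pow (Matrix.reindexAlgEquiv ℝ ℝ e) T N).symm
    rw [this]
    exact hε _ _

theorem fromBlocks_zero_pow [Fintype m] [Fintype n] [DecidableEq m] [DecidableEq n] (A : Matrix m m ℝ) (B : Matrix m n ℝ)
    (D : Matrix n n ℝ) (r : ℕ) :
    ∃ X, Matrix.fromBlocks A B 0 D ^ r = Matrix.fromBlocks (A ^ r) X 0 (D ^ r) := by
  induction r with
  | zero => exact ⟨0, by simp [Matrix.fromBlocks_one]⟩
  | succ r ih =>
    obtain ⟨X, hX⟩ := ih
    exact ⟨A ^ r * B + X * D, by simp [pow_succ, hX, Matrix.fromBlocks_multiply]⟩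

/-- The combined matrix of a team (with combination matrix `A`) and of the agents that infer its
strategies is mixing when each of the latter is reached from the team. -/
theorem mixing_fromBlocks [Fintype m] [Fintype n] [DecidableEq m] [DecidableEq n] {A : Matrix m m ℝ} {B : Matrix m n ℝ}
    {D : Matrix n n ℝ} {p : m → ℝ} (hA : LeftStochastic A) (hprim : A.IsPrimitive)
    (hfix : A.mulVec p = p) (hp : ∀ k, 0 < p k) (hsum : ∑ k, p k = 1)
    (hB : ∀ l k, 0 ≤ B l k) (hD : ∀ l k, 0 ≤ D l k) (hBD : ∀ k, ∑ l, B l k + ∑ l, D l k = 1)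
    (hreach : ∀ k, ∃ r k₀ l, 0 < (D ^ r) k₀ k ∧ 0 < B l k₀) :
    Mixing (Matrix.fromBlocks A (A * B) 0 D) (Sum.elim p 0) := by
  have hT : LeftStochastic (Matrix.fromBlocks A (A * B) 0 D) := by
    refine ⟨?_, ?_⟩
    · rintro (l | l) (k | k)
      · exact hA.1 l k
      · exact Finset.sum_nonneg fun j _ => mul_nonneg (hA.1 l j) (hB j k)
      · exact le_rfl
      · exact hD l k
    · rintro (k | k)
      · simpa [Fintype.sum_sum_type] using hA.2 k
      · have h1 : ∑ l, (A * B) l k = ∑ l, B l k := by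
          simp only [Matrix.mul_apply]
          rw [Finset.sum_comm]
          simp only [← Finset.sum_mul, hA.2, one_mul]
        simpa [Fintype.sum_sum_type, h1] using hBD k
  refine ⟨hT, ?_, ?_, ?_, ?_⟩
  · ext (k | k)
    · simpa [Matrix.mulVec, dotProduct, Fintype.sum_sum_type] using congrFun hfix k
    · simp [Matrix.mulVec, dotProduct, Fintype.sum_sum_type]
  · rintro (k | k)
    · exact (hp k).le
    · exact le_rfl
  · simpa [Fintype.sum_sum_type] using hsum
  · set T := Matrix.fromBlocks A (A * B) 0 D with hTdef
    obtain ⟨r₀, hr₀, hpos⟩ := hA.exists_forall_ge_pow_pos hprim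
    have hpow : ∀ t ≥ r₀, ∀ l j, 0 < (T ^ t) (Sum.inl l) (Sum.inl j) := fun t ht l j => by
      obtain ⟨X, hX⟩ := fromBlocks_zero_pow A (A * B) D t
      rw [hTdef, hX]
      exact hpos t ht l j
    -- A positive entry `(l, k)` of `T ^ r` is a path of length `r` from `l` to `k`. An estimating
    -- agent is reached by a link `j → k₀` through `A * B`, followed by `r` steps inside `D`.
    have hr : ∀ k, ∃ r j, 0 < (T ^ r) (Sum.inl j) k := by
      rintro (k | k)
      · exact ⟨0, k, by simp⟩
      · obtain ⟨r, k₀, l, h1, h2⟩ := hreach k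
        obtain ⟨j, hj⟩ := hA.exists_pos l
        refine ⟨r + 1, j, ?_⟩
        rw [pow_succ']
        refine mul_apply_pos hT.1 (hT.pow r).1 (j := Sum.inr k₀) ?_ ?_
        · exact mul_apply_pos hA.1 hB hj h2
        · obtain ⟨X, hX⟩ := fromBlocks_zero_pow A (A * B) D r
          rw [hTdef, hX]
          exact h1
    choose r j hrj using hr
    have hle : ∀ k, r k ≤ ∑ k, r k := fun k =>
      Finset.single_le_sum (fun _ _ => Nat.zero_le _) (Finset.mem_univ k)
    have hN : ∀ (l : m) k, 0 < (T ^ (r₀ + ∑ k, r k)) (Sum.inl l) k := fun l k => by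
      -- One exponent serves all `k`: the last `r k` steps lead from `j k` to `k`, and at least `r₀`
      -- steps remain inside the team, where all entries are positive.
      have : r₀ + ∑ k, r k = (r₀ + (∑ k, r k - r k)) + r k := by have := hle k; omega
      rw [this, pow_add]
      exact mul_apply_pos (hT.pow _).1 (hT.pow _).1 (hpow _ (by omega) l (j k)) (hrj k)
    obtain ⟨ε, h0, h1, hε⟩ := exists_pos_le_of_forall_pos
      (fun q : m × (m ⊕ n) => (T ^ (r₀ + ∑ k, r k)) (Sum.inl q.1) q.2) fun q => hN q.1 q.2
    refine ⟨r₀ + ∑ k, r k, by omega, ε, h0, h1, ?_⟩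
    -- On the team `p l ≤ 1`, so `ε` itself is a lower bound; on the estimating agents the invariant
    -- vector vanishes.
    rintro (l | l) k
    · have hpl : p l ≤ 1 := hsum ▸ Finset.single_le_sum (f := p) (fun i _ => (hp i).le)
        (Finset.mem_univ l)
      calc ε * p l ≤ ε * 1 := by gcongr
        _ ≤ _ := by rw [mul_one]; exact hε (l, k)
    · simpa using (hT.pow _).1 (Sum.inr l) k

end Stochastic

/-! ### Averaging of vectors -/

section Averaging

variable {ι : Type*} [Fintype ι]

/-- Combination of vectors with the columns of a matrix. -/
def combine {E : Type*} [NormedAddCommGroup E] [NormedSpace ℝ E] (T : Matrix ι ι ℝ)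
    (u : ι → E) (k : ι) : E :=
  ∑ l, T l k • u l

variable {E : Type*} [NormedAddCommGroup E] [NormedSpace ℝ E]

theorem combine_one [DecidableEq ι] (u : ι → E) : combine (1 : Matrix ι ι ℝ) u = u := by
  ext k
  simp [combine, Matrix.one_apply]

theorem combine_combine (S T : Matrix ι ι ℝ) (u : ι → E) :
    combine T (combine S u) = combine (S * T) u := by
  ext k
  simp only [combine, Matrix.mul_apply, Finset.smul_sum, Finset.sum_smul, smul_smul]
  rw [Finset.sum_comm]
  simp only [mul_comm]

theorem combine_add (T : Matrix ι ι ℝ) (u v : ι → E) :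
    combine T (u + v) = combine T u + combine T v := by
  ext k
  simp [combine, Finset.sum_add_distrib]

theorem combine_const {T : Matrix ι ι ℝ} (hT : LeftStochastic T) (e : E) :
    combine T (fun _ => e) = fun _ => e := by
  ext k
  simp [combine, ← Finset.sum_smul, hT.2]

theorem norm_sum_smul_le {a : ι → ℝ} (ha : ∀ l, 0 ≤ a l) {u : ι → E} {R : ℝ}
    (hu : ∀ l, ‖u l‖ ≤ R) : ‖∑ l, a l • u l‖ ≤ (∑ l, a l) * R := by
  rw [Finset.sum_mul]
  refine norm_sum_le_of_le _ fun l _ => ?_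
  rw [norm_smul, Real.norm_of_nonneg (ha l)]
  exact mul_le_mul_of_nonneg_left (hu l) (ha l)

theorem norm_combine_le {T : Matrix ι ι ℝ} (hT : LeftStochastic T) (u : ι → E) :
    ‖combine T u‖ ≤ ‖u‖ := by
  refine (pi_norm_le_iff_of_nonneg (norm_nonneg u)).2 fun k => ?_
  simpa [combine, hT.2] using norm_sum_smul_le (fun l => hT.1 l k) (norm_le_pi_norm u)

/-- `combine` averages along columns, so a right eigenvector of `T` gives a conserved weighted mean.
-/
theorem sum_smul_combine {T : Matrix ι ι ℝ} {w : ι → ℝ} (h : T.mulVec w = w) (u : ι → E) :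
    ∑ k, w k • combine T u k = ∑ k, w k • u k := by
  simp only [combine, Finset.smul_sum, smul_smul]
  rw [Finset.sum_comm]
  refine Finset.sum_congr rfl fun l _ => ?_
  rw [← Finset.sum_smul]
  congr 1
  conv_rhs => rw [← h]
  simp [Matrix.mulVec, dotProduct, mul_comm]

/-- A weighted sum of the sup norms of the first `N` iterates of `combine T`. -/
noncomputable def mixNorm [DecidableEq ι] (T : Matrix ι ι ℝ) (γ : ℝ) (N : ℕ) (u : ι → E) : ℝ :=
  ∑ j ∈ Finset.range N, γ⁻¹ ^ j * ‖combine (T ^ j) u‖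

theorem mixNorm_zero [DecidableEq ι] (T : Matrix ι ι ℝ) (γ : ℝ) (N : ℕ) :
    mixNorm T γ N (fun _ : ι => (0 : E)) = 0 := by
  refine Finset.sum_eq_zero fun j _ => ?_
  have : combine (T ^ j) (fun _ : ι => (0 : E)) = 0 := by
    ext k
    simp [combine]
  rw [this, norm_zero, mul_zero]

theorem mixNorm_nonneg [DecidableEq ι] (T : Matrix ι ι ℝ) {γ : ℝ} (hγ : 0 ≤ γ) (N : ℕ)
    (u : ι → E) : 0 ≤ mixNorm T γ N u :=
  Finset.sum_nonneg fun _ _ => by positivity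

theorem mixNorm_add_le [DecidableEq ι] (T : Matrix ι ι ℝ) {γ : ℝ} (hγ : 0 < γ) (N : ℕ)
    (u v : ι → E) : mixNorm T γ N (u + v) ≤ mixNorm T γ N u + mixNorm T γ N v := by
  rw [mixNorm, mixNorm, mixNorm, ← Finset.sum_add_distrib]
  refine Finset.sum_le_sum fun j _ => ?_
  rw [← mul_add, combine_add]
  gcongr
  exact norm_add_le _ _

theorem norm_le_mixNorm [DecidableEq ι] (T : Matrix ι ι ℝ) {γ : ℝ} (hγ : 0 < γ) {N : ℕ}
    (hN : 0 < N) (u : ι → E) : ‖u‖ ≤ mixNorm T γ N u := by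
  have := Finset.single_le_sum (f := fun j => γ⁻¹ ^ j * ‖combine (T ^ j) u‖)
    (fun j _ => by positivity) (Finset.mem_range.2 hN)
  simpa [mixNorm, combine_one] using this

theorem mixNorm_le [DecidableEq ι] {T : Matrix ι ι ℝ} (hT : LeftStochastic T) {γ : ℝ}
    (hγ : 0 < γ) (N : ℕ) (u : ι → E) :
    mixNorm T γ N u ≤ (∑ j ∈ Finset.range N, γ⁻¹ ^ j) * ‖u‖ := by
  rw [mixNorm, Finset.sum_mul]
  gcongr
  exact norm_combine_le (hT.pow _) u

/-- Applying `T` shifts the defining sum by one index, at the price of a factor `γ`. The new last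
term is at most the lost first term `‖u‖` by the bound for the `N`-th power. -/
theorem mixNorm_combine_le [DecidableEq ι] {T : Matrix ι ι ℝ} {γ : ℝ} (hγ : 0 < γ) {N : ℕ}
    {u : ι → E} (hu : ‖combine (T ^ N) u‖ ≤ γ ^ N * ‖u‖) :
    mixNorm T γ N (combine T u) ≤ γ * mixNorm T γ N u := by
  have h1 : mixNorm T γ N (combine T u)
      = γ * ∑ j ∈ Finset.range N, γ⁻¹ ^ (j + 1) * ‖combine (T ^ (j + 1)) u‖ := by
    rw [mixNorm, Finset.mul_sum]
    refine Finset.sum_congr rfl fun j _ => ?_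
    rw [combine_combine, ← pow_succ', pow_succ γ⁻¹]
    field_simp
  have h2 := Finset.sum_range_succ' (fun j => γ⁻¹ ^ j * ‖combine (T ^ j) u‖) N
  rw [Finset.sum_range_succ] at h2
  have h3 : γ⁻¹ ^ N * ‖combine (T ^ N) u‖ ≤ ‖u‖ := by
    rw [inv_pow, inv_mul_le_iff₀ (by positivity)]
    exact hu
  rw [h1]
  refine mul_le_mul_of_nonneg_left ?_ hγ.le
  simp only [pow_zero, one_mul, combine_one] at h2
  rw [mixNorm]
  linarith

/-- Doeblin's argument: subtracting `ε w l` from each entry changes nothing on vectors of weighted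
mean zero, and leaves nonnegative columns of sum `1 - ε`. -/
theorem norm_combine_le_of_minorized {T : Matrix ι ι ℝ} (hT : LeftStochastic T) {w : ι → ℝ}
    (hw : ∑ k, w k = 1) {ε : ℝ} (hε : ∀ l k, ε * w l ≤ T l k) (h1 : ε ≤ 1) {u : ι → E}
    (hu : ∑ k, w k • u k = 0) : ‖combine T u‖ ≤ (1 - ε) * ‖u‖ := by
  refine (pi_norm_le_iff_of_nonneg (mul_nonneg (by linarith) (norm_nonneg u))).2 fun k => ?_
  have h2 : combine T u k = ∑ l, (T l k - ε * w l) • u l := by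
    simp only [combine, sub_smul, Finset.sum_sub_distrib, mul_smul, ← Finset.smul_sum, hu]
    simp
  have h3 : ∑ l, (T l k - ε * w l) = 1 - ε := by
    rw [Finset.sum_sub_distrib, hT.2, ← Finset.mul_sum, hw, mul_one]
  rw [h2, ← h3]
  exact norm_sum_smul_le (fun l => sub_nonneg.2 (hε l k)) (norm_le_pi_norm u)

/-- Geometric contraction of `combine T` on the vectors with vanishing weighted mean. -/
theorem Mixing.exists_contraction [DecidableEq ι] {T : Matrix ι ι ℝ} {w : ι → ℝ}
    (h : Mixing T w) : ∃ (γ : ℝ) (N : ℕ), 0 < γ ∧ γ < 1 ∧ 0 < N ∧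
      ∀ (E : Type) [NormedAddCommGroup E] [NormedSpace ℝ E] (u : ι → E), ∑ k, w k • u k = 0 →
        mixNorm T γ N (combine T u) ≤ γ * mixNorm T γ N u := by
  obtain ⟨N, hN, ε, h0, h1, hε⟩ := h.minorized
  have hN' : (1 : ℝ) ≤ N := by exact_mod_cast hN
  have hdiv : ε / N ≤ 1 / 2 := (div_le_self h0.le hN').trans h1
  have hdiv0 : 0 < ε / N := by positivity
  -- Bernoulli's inequality gives `1 - ε ≤ (1 - ε / N) ^ N`.
  refine ⟨1 - ε / N, N, by linarith, by linarith, hN, fun E _ _ u hu => ?_⟩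
  refine mixNorm_combine_le (by linarith) ?_
  refine (norm_combine_le_of_minorized (h.stochastic.pow N) h.sum_eq_one hε (by linarith)
    hu).trans ?_
  gcongr
  have := one_add_mul_le_pow (a := -(ε / N)) (by linarith) N
  calc 1 - ε = 1 + N * -(ε / N) := by field_simp; ring
    _ ≤ _ := this
    _ = _ := by ring

/-- One step of diffusion with a mixing matrix: drift of the weighted mean. -/
theorem Mixing.diffusion_mean [DecidableEq ι] {T : Matrix ι ι ℝ} {w : ι → ℝ} (h : Mixing T w)
    (μ : ℝ) (x g : ι → E) :
    ∑ k, w k • combine T (x - μ • g) k = ∑ k, w k • x k - μ • ∑ k, w k • g k := by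
  rw [sum_smul_combine h.invariant]
  simp [smul_sub, Finset.sum_sub_distrib, Finset.smul_sum, smul_comm μ]

theorem Mixing.norm_mean_sub_le [DecidableEq ι] {T : Matrix ι ι ℝ} {w : ι → ℝ} (h : Mixing T w)
    {g : ι → E} {e : E} {R : ℝ} (hR : ∀ k, ‖g k - e‖ ≤ R) : ‖∑ k, w k • g k - e‖ ≤ R := by
  have := norm_sum_smul_le h.nonneg hR
  rwa [h.sum_eq_one, one_mul, Finset.sum_congr rfl fun k _ => smul_sub (w k) (g k) e,
    Finset.sum_sub_distrib, ← Finset.sum_smul, h.sum_eq_one, one_smul] at this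

/-- One step of diffusion with a mixing matrix: contraction of the disagreement. -/
theorem Mixing.diffusion_disagreement [DecidableEq ι] {T : Matrix ι ι ℝ} {w : ι → ℝ}
    (h : Mixing T w) {γ : ℝ} {N : ℕ} (hγ : 0 < γ) (hγ1 : γ ≤ 1)
    (hcon : ∀ u : ι → E, ∑ k, w k • u k = 0 →
      mixNorm T γ N (combine T u) ≤ γ * mixNorm T γ N u)
    {μ : ℝ} (hμ : 0 ≤ μ) (x g : ι → E) (e : E) {R : ℝ} (hR : ∀ k, ‖g k - e‖ ≤ R) (hR0 : 0 ≤ R) :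
    mixNorm T γ N (fun k => combine T (x - μ • g) k - ∑ j, w j • combine T (x - μ • g) j)
      ≤ γ * mixNorm T γ N (fun k => x k - ∑ j, w j • x j)
        + μ * (2 * (∑ j ∈ Finset.range N, γ⁻¹ ^ j) * R) := by
  set K := ∑ j ∈ Finset.range N, γ⁻¹ ^ j
  have hK : 0 ≤ K := Finset.sum_nonneg fun j _ => by positivity
  have hmean := h.norm_mean_sub_le hR
  set xc := ∑ j, w j • x j with hxc
  set gc := ∑ j, w j • g j with hgc
  -- Only deviations from the mean direction create disagreement. Both `g k` and `gc` are within `R`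
  -- of `e`, hence the constant `2 * R`.
  set v : ι → E := fun k => -(μ • (g k - gc)) with hv
  have hvn : ‖v‖ ≤ μ * (2 * R) := by
    refine (pi_norm_le_iff_of_nonneg (by positivity)).2 fun k => ?_
    rw [hv, norm_neg, norm_smul, Real.norm_of_nonneg hμ]
    gcongr
    calc ‖g k - gc‖ = ‖(g k - e) - (gc - e)‖ := by congr 1; abel
      _ ≤ _ := norm_sub_le _ _
      _ ≤ 2 * R := by linarith [hR k]
  have hstep : (fun k => combine T (x - μ • g) k - ∑ j, w j • combine T (x - μ • g) j)
      = combine T ((fun k => x k - xc) + v) := by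
    ext k
    rw [h.diffusion_mean]
    have h1 : x - μ • g = ((fun k => x k - xc) + v) + fun _ => xc - μ • gc := by
      ext k; simp only [hv, Pi.add_apply, Pi.sub_apply, Pi.smul_apply, smul_sub]; abel
    conv_lhs => rw [h1, combine_add, Pi.add_apply, combine_const h.stochastic]
    rw [add_sub_cancel_right]
  have hzero : ∑ k, w k • ((fun k => x k - xc) + v) k = 0 := by
    simp only [hv, Pi.add_apply, smul_add, smul_sub, smul_neg, Finset.sum_add_distrib,
      Finset.sum_sub_distrib, ← Finset.sum_smul, Finset.sum_neg_distrib, h.sum_eq_one, one_smul,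
      smul_comm _ μ, ← Finset.smul_sum]
    rw [← hxc, ← hgc]
    simp
  rw [hstep]
  calc _ ≤ γ * mixNorm T γ N ((fun k => x k - xc) + v) := hcon _ hzero
    _ ≤ γ * (mixNorm T γ N (fun k => x k - xc) + K * (μ * (2 * R))) := by
        gcongr
        refine (mixNorm_add_le T hγ N _ _).trans ?_
        gcongr
        refine (mixNorm_le h.stochastic hγ N v).trans ?_
        gcongr
    _ ≤ _ := by
        have h2 : γ * (K * (μ * (2 * R))) ≤ 1 * (K * (μ * (2 * R))) := by gcongr
        linarith

end Averaging

/-! ### Gradients of weighted risks -/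

section Gradients

theorem gradient_sum_mul {ι F : Type*} [Fintype ι] [NormedAddCommGroup F] [InnerProductSpace ℝ F]
    [CompleteSpace F] (p : ι → ℝ) (f : ι → F → ℝ) (x : F)
    (hf : ∀ k, DifferentiableAt ℝ (f k) x) :
    gradient (fun x => ∑ k, p k * f k x) x = ∑ k, p k • gradient (f k) x := by
  simp only [gradient]
  rw [fderiv_fun_sum fun k _ => (hf k).const_mul (p k), map_sum]
  refine Finset.sum_congr rfl fun k _ => ?_
  rw [fderiv_const_mul (hf k)]
  simp

theorem norm_sum_smul_sub_sum_smul_le {ι F : Type*} [Fintype ι] [NormedAddCommGroup F]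
    [NormedSpace ℝ F] {p : ι → ℝ} (hp : ∀ k, 0 ≤ p k) (hsum : ∑ k, p k = 1) {u v : ι → F} {R : ℝ}
    (h : ∀ k, ‖u k - v k‖ ≤ R) : ‖∑ k, p k • u k - ∑ k, p k • v k‖ ≤ R := by
  rw [← Finset.sum_sub_distrib]
  simp only [← smul_sub]
  simpa [hsum] using norm_sum_smul_le hp h

variable {K₁ K₂ M₁ M₂ : ℕ}

theorem gradX_neg (f : Vec M₁ → Vec M₂ → ℝ) (x : Vec M₁) (y : Vec M₂) :
    gradX (fun x y => -f x y) x y = -gradX f x y := by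
  simp [gradX, gradient, fderiv_fun_neg]

theorem gradY_neg (f : Vec M₁ → Vec M₂ → ℝ) (x : Vec M₁) (y : Vec M₂) :
    gradY (fun x y => -f x y) x y = -gradY f x y := by
  simp [gradY, gradient, fderiv_fun_neg]

/-- Joint Lipschitz continuity of both partial gradients. -/
def LipschitzGrad (f : Vec M₁ → Vec M₂ → ℝ) (L : ℝ) : Prop :=
  ∀ x₁ x₂ y₁ y₂,
    ‖gradX f x₁ y₁ - gradX f x₂ y₂‖ ≤ L * (‖x₁ - x₂‖ + ‖y₁ - y₂‖) ∧
    ‖gradY f x₁ y₁ - gradY f x₂ y₂‖ ≤ L * (‖x₁ - x₂‖ + ‖y₁ - y₂‖)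

theorem lipschitzGrad_sum_mul {ι : Type*} [Fintype ι] {p : ι → ℝ} (hp : ∀ k, 0 ≤ p k)
    (hsum : ∑ k, p k = 1) {f : ι → Vec M₁ → Vec M₂ → ℝ} {L : ℝ}
    (hf : ∀ k x y, DifferentiableAt ℝ (fun x' => f k x' y) x ∧
      DifferentiableAt ℝ (fun y' => f k x y') y)
    (hL : ∀ k, LipschitzGrad (f k) L) :
    LipschitzGrad (fun x y => ∑ k, p k * f k x y) L := by
  intro x₁ x₂ y₁ y₂
  constructor
  · simp only [gradX]
    rw [gradient_sum_mul p (fun k x' => f k x' y₁) x₁ fun k => (hf k x₁ y₁).1,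
      gradient_sum_mul p (fun k x' => f k x' y₂) x₂ fun k => (hf k x₂ y₂).1]
    exact norm_sum_smul_sub_sum_smul_le hp hsum fun k => (hL k x₁ x₂ y₁ y₂).1
  · simp only [gradY]
    rw [gradient_sum_mul p (fun k y' => f k x₁ y') y₁ fun k => (hf k x₁ y₁).2,
      gradient_sum_mul p (fun k y' => f k x₂ y') y₂ fun k => (hf k x₂ y₂).2]
    exact norm_sum_smul_sub_sum_smul_le hp hsum fun k => (hL k x₁ x₂ y₁ y₂).2

theorem LipschitzGrad.mono {f : Vec M₁ → Vec M₂ → ℝ} {L L' : ℝ} (h : LipschitzGrad f L)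
    (hL : L ≤ L') : LipschitzGrad f L' := fun x₁ x₂ y₁ y₂ =>
  ⟨(h x₁ x₂ y₁ y₂).1.trans (mul_le_mul_of_nonneg_right hL (by positivity)),
    (h x₁ x₂ y₁ y₂).2.trans (mul_le_mul_of_nonneg_right hL (by positivity))⟩

theorem continuous_of_norm_sub_le_mul_add {E F H : Type*} [NormedAddCommGroup E]
    [NormedAddCommGroup F] [NormedAddCommGroup H] {f : E → F → H} {L : ℝ}
    (hf : ∀ x₁ x₂ y₁ y₂, ‖f x₁ y₁ - f x₂ y₂‖ ≤ L * (‖x₁ - x₂‖ + ‖y₁ - y₂‖)) :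
    Continuous fun q : E × F => f q.1 q.2 := by
  refine continuous_iff_continuousAt.2 fun q₀ => ?_
  rw [ContinuousAt, tendsto_iff_norm_sub_tendsto_zero]
  refine squeeze_zero (fun _ => norm_nonneg _) (fun q => hf q.1 q₀.1 q.2 q₀.2) ?_
  have : Continuous fun q : E × F => L * (‖q.1 - q₀.1‖ + ‖q.2 - q₀.2‖) := by fun_prop
  simpa using this.tendsto q₀

theorem LipschitzGrad.continuous_gradX {f : Vec M₁ → Vec M₂ → ℝ} {L : ℝ}
    (h : LipschitzGrad f L) : Continuous fun q : Vec M₁ × Vec M₂ => gradX f q.1 q.2 :=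
  continuous_of_norm_sub_le_mul_add fun x₁ x₂ y₁ y₂ => (h x₁ x₂ y₁ y₂).1

theorem LipschitzGrad.continuous_gradY {f : Vec M₁ → Vec M₂ → ℝ} {L : ℝ}
    (h : LipschitzGrad f L) : Continuous fun q : Vec M₁ × Vec M₂ => gradY f q.1 q.2 :=
  continuous_of_norm_sub_le_mul_add fun x₁ x₂ y₁ y₂ => (h x₁ x₂ y₁ y₂).2

namespace StochasticGame

variable {g : StochasticGame K₁ K₂ M₁ M₂} {p₁ : Fin K₁ → ℝ} {p₂ : Fin K₂ → ℝ} {L G : ℝ}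

theorem LipschitzGradients.risk₁ (h : g.LipschitzGradients L) (hp : ∀ k, 0 < p₁ k)
    (hsum : ∑ k, p₁ k = 1) : LipschitzGrad (g.risk₁ p₁) L :=
  lipschitzGrad_sum_mul (fun k => (hp k).le) hsum (fun k => (h (Sum.inl k)).1)
    fun k => (h (Sum.inl k)).2

theorem LipschitzGradients.risk₂ (h : g.LipschitzGradients L) (hp : ∀ k, 0 < p₂ k)
    (hsum : ∑ k, p₂ k = 1) : LipschitzGrad (g.risk₂ p₂) L :=
  lipschitzGrad_sum_mul (fun k => (hp k).le) hsum (fun k => (h (Sum.inr k)).1)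
    fun k => (h (Sum.inr k)).2

theorem ZeroSum.gradX_eq (h : g.ZeroSum p₁ p₂) (x : Vec M₁) (y : Vec M₂) :
    gradX (g.risk₁ p₁) x y = -gradX (g.risk₂ p₂) x y := by
  rw [← gradX_neg]
  congr
  ext x y
  exact h x y

theorem ZeroSum.gradY_eq (h : g.ZeroSum p₁ p₂) (x : Vec M₁) (y : Vec M₂) :
    gradY (g.risk₂ p₂) x y = -gradY (g.risk₁ p₁) x y := by
  rw [← gradY_neg]
  congr
  ext x y
  rw [h x y, neg_neg]

end StochasticGame

/-- Deviation of an inexact local gradient `u` from the global gradient at another point. -/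
theorem norm_sub_le_of_three {E : Type*} [NormedAddCommGroup E] {u a b h : E} {r₁ r₂ r₃ : ℝ}
    (h₁ : ‖u - a‖ ≤ r₁) (h₂ : ‖a - b‖ ≤ r₂) (h₃ : ‖b - h‖ ≤ r₃) :
    ‖u - h‖ ≤ r₁ + r₂ + r₃ := by
  calc ‖u - h‖ = ‖(u - a) + (a - b) + (b - h)‖ := by congr 1; abel
    _ ≤ _ := norm_add₃_le
    _ ≤ _ := by gcongr

end Gradients

/-! ### The algorithms as diffusions over all agents -/

section Diffusion

variable {K₁ K₂ M₁ M₂ : ℕ}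

/-- Combined matrix of all agents for the strategies of Team 1. -/
noncomputable def matX (A₁ : Matrix (Fin K₁) (Fin K₁) ℝ)
    (C : Matrix (Agent K₁ K₂) (Agent K₁ K₂) ℝ) : Matrix (Agent K₁ K₂) (Agent K₁ K₂) ℝ :=
  Matrix.fromBlocks A₁ (A₁ * C.toBlocks₁₂) 0 C.toBlocks₂₂

/-- Combined matrix of all agents for the strategies of Team 2. -/
noncomputable def matY (A₂ : Matrix (Fin K₂) (Fin K₂) ℝ)
    (C : Matrix (Agent K₁ K₂) (Agent K₁ K₂) ℝ) : Matrix (Agent K₁ K₂) (Agent K₁ K₂) ℝ :=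
  Matrix.reindex (Equiv.sumComm _ _) (Equiv.sumComm _ _)
    (Matrix.fromBlocks A₂ (A₂ * C.toBlocks₂₁) 0 C.toBlocks₁₁)

/-- Substituting the new strategies into the inference step produces the block `A₁ * C₁₂`. The sign
flip on Team 2 turns its ascent step into a descent step. -/
theorem stepITC_fst (A₁ : Matrix (Fin K₁) (Fin K₁) ℝ) (A₂ : Matrix (Fin K₂) (Fin K₂) ℝ)
    (C : Matrix (Agent K₁ K₂) (Agent K₁ K₂) ℝ) (μ : ℝ) (dx : Agent K₁ K₂ → Vec M₁)
    (dy : Agent K₁ K₂ → Vec M₂) (s : Profile K₁ K₂ M₁ M₂) (v : Agent K₁ K₂ → Vec M₁)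
    (h₁ : ∀ l, v (Sum.inl l) = dx (Sum.inl l))
    (h₂ : (∀ l, v (Sum.inr l) = -dx (Sum.inr l)) ∨ C.toBlocks₂₂ = 0) :
    (stepITC A₁ A₂ C μ dx dy s).1 = combine (matX A₁ C) (s.1 - μ • v) := by
  ext1 k
  rcases k with k | k
  · simp [stepITC, adaptCombine₁, combine, matX, Fintype.sum_sum_type, h₁]
  · simp only [stepITC, adaptCombine₁, combine, matX, Fintype.sum_sum_type, Sum.elim_inr,
      Matrix.fromBlocks_apply₁₂, Matrix.fromBlocks_apply₂₂, Matrix.mul_apply, Pi.sub_apply,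
      Pi.smul_apply, h₁, Finset.sum_smul, Finset.smul_sum, smul_smul]
    congr 1
    · rw [Finset.sum_comm]
      simp only [mul_comm, Matrix.toBlocks₁₂, Matrix.of_apply]
    · refine Finset.sum_congr rfl fun l _ => ?_
      rcases h₂ with h₂ | h₂
      · rw [h₂, smul_neg, sub_neg_eq_add]; rfl
      · have : C (Sum.inr l) (Sum.inr k) = 0 := congrFun (congrFun h₂ l) k
        rw [this, h₂]; simp

theorem stepITC_snd (A₁ : Matrix (Fin K₁) (Fin K₁) ℝ) (A₂ : Matrix (Fin K₂) (Fin K₂) ℝ)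
    (C : Matrix (Agent K₁ K₂) (Agent K₁ K₂) ℝ) (μ : ℝ) (dx : Agent K₁ K₂ → Vec M₁)
    (dy : Agent K₁ K₂ → Vec M₂) (s : Profile K₁ K₂ M₁ M₂) (v : Agent K₁ K₂ → Vec M₂)
    (h₁ : ∀ l, v (Sum.inr l) = dy (Sum.inr l))
    (h₂ : (∀ l, v (Sum.inl l) = -dy (Sum.inl l)) ∨ C.toBlocks₁₁ = 0) :
    (stepITC A₁ A₂ C μ dx dy s).2 = combine (matY A₂ C) (s.2 - μ • v) := by
  ext1 k
  rcases k with k | k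
  · simp only [stepITC, adaptCombine₂, combine, matY, Fintype.sum_sum_type, Sum.elim_inl,
      Matrix.reindex_apply, Matrix.submatrix_apply, Equiv.sumComm_symm, Equiv.sumComm_apply,
      Sum.swap_inl, Sum.swap_inr,
      Matrix.fromBlocks_apply₁₂, Matrix.fromBlocks_apply₂₂, Matrix.mul_apply, Pi.sub_apply,
      Pi.smul_apply, h₁, Finset.sum_smul, Finset.smul_sum, smul_smul]
    rw [add_comm]
    congr 1
    · refine Finset.sum_congr rfl fun l _ => ?_
      rcases h₂ with h₂ | h₂
      · rw [h₂, smul_neg, sub_neg_eq_add]; rfl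
      · have : C (Sum.inl l) (Sum.inl k) = 0 := congrFun (congrFun h₂ l) k
        rw [this, h₂]; simp
    · rw [Finset.sum_comm]
      simp only [mul_comm, Matrix.toBlocks₂₁, Matrix.of_apply]
  · simp [stepITC, adaptCombine₂, combine, matY, Fintype.sum_sum_type, h₁]

theorem stepC_eq_stepITC {C : Matrix (Agent K₁ K₂) (Agent K₁ K₂) ℝ} (h₁ : C.toBlocks₁₁ = 0)
    (h₂ : C.toBlocks₂₂ = 0) (A₁ : Matrix (Fin K₁) (Fin K₁) ℝ) (A₂ : Matrix (Fin K₂) (Fin K₂) ℝ)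
    (μ : ℝ) :
    stepC (M₁ := M₁) (M₂ := M₂) A₁ A₂ C μ = stepITC A₁ A₂ C μ := by
  have h₁' : ∀ l k, C (Sum.inl l) (Sum.inl k) = 0 := fun l k => congrFun (congrFun h₁ l) k
  have h₂' : ∀ l k, C (Sum.inr l) (Sum.inr k) = 0 := fun l k => congrFun (congrFun h₂ l) k
  funext dx dy s
  simp [stepC, stepITC, h₁', h₂']

theorem mixing_matX {A₁ : Matrix (Fin K₁) (Fin K₁) ℝ} {C : Matrix (Agent K₁ K₂) (Agent K₁ K₂) ℝ}
    {p₁ : Fin K₁ → ℝ} (hA : WithinTeam A₁) (hp : IsPerronVector A₁ p₁)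
    (hC : LeftStochastic C)
    (hreach : ∀ k, ∃ r k₀ l, 0 < (C.toBlocks₂₂ ^ r) k₀ k ∧ 0 < C.toBlocks₁₂ l k₀) :
    Mixing (matX A₁ C) (Sum.elim p₁ 0) :=
  mixing_fromBlocks hA.2 hA.1 hp.1 hp.2.1 hp.2.2 (fun _ _ => hC.1 _ _) (fun _ _ => hC.1 _ _)
    (fun k => by rw [← hC.2 (Sum.inr k), Fintype.sum_sum_type]; rfl) hreach

theorem mixing_matY {A₂ : Matrix (Fin K₂) (Fin K₂) ℝ} {C : Matrix (Agent K₁ K₂) (Agent K₁ K₂) ℝ}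
    {p₂ : Fin K₂ → ℝ} (hA : WithinTeam A₂) (hp : IsPerronVector A₂ p₂)
    (hC : LeftStochastic C)
    (hreach : ∀ k, ∃ r k₀ l, 0 < (C.toBlocks₁₁ ^ r) k₀ k ∧ 0 < C.toBlocks₂₁ l k₀) :
    Mixing (matY A₂ C) (Sum.elim 0 p₂) := by
  have := (mixing_fromBlocks hA.2 hA.1 hp.1 hp.2.1 hp.2.2 (B := C.toBlocks₂₁)
    (D := C.toBlocks₁₁) (fun _ _ => hC.1 _ _) (fun _ _ => hC.1 _ _)
    (fun k => by rw [← hC.2 (Sum.inl k), Fintype.sum_sum_type, add_comm]; rfl) hreach).reindex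
    (Equiv.sumComm _ _)
  have hw : (Sum.elim 0 p₂ : Agent K₁ K₂ → ℝ) = Sum.elim p₂ 0 ∘ (Equiv.sumComm _ _).symm := by
    funext k
    rcases k with k | k <;> rfl
  rw [hw]
  exact this

theorem StrongCross.leftStochastic {C : Matrix (Agent K₁ K₂) (Agent K₁ K₂) ℝ}
    (h : StrongCross C) : LeftStochastic C := by
  obtain ⟨h₁, h₂, h₁₂, h₂₁⟩ := h
  have h₁' : ∀ l k, C (Sum.inl l) (Sum.inl k) = 0 := fun l k => congrFun (congrFun h₁ l) k
  have h₂' : ∀ l k, C (Sum.inr l) (Sum.inr k) = 0 := fun l k => congrFun (congrFun h₂ l) k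
  refine ⟨?_, ?_⟩
  · rintro (l | l) (k | k)
    · exact (h₁' l k).ge
    · exact h₁₂.1 l k
    · exact h₂₁.1 l k
    · exact (h₂' l k).ge
  · rintro (k | k)
    · simpa [Fintype.sum_sum_type, h₁', Matrix.toBlocks₂₁] using h₂₁.2 k
    · simpa [Fintype.sum_sum_type, h₂', Matrix.toBlocks₁₂] using h₁₂.2 k

theorem StrongCross.mixing {A₁ : Matrix (Fin K₁) (Fin K₁) ℝ} {A₂ : Matrix (Fin K₂) (Fin K₂) ℝ}
    {C : Matrix (Agent K₁ K₂) (Agent K₁ K₂) ℝ} {p₁ : Fin K₁ → ℝ} {p₂ : Fin K₂ → ℝ}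
    (h : StrongCross C) (hA₁ : WithinTeam A₁) (hA₂ : WithinTeam A₂)
    (hp₁ : IsPerronVector A₁ p₁) (hp₂ : IsPerronVector A₂ p₂) :
    Mixing (matX A₁ C) (Sum.elim p₁ 0) ∧ Mixing (matY A₂ C) (Sum.elim 0 p₂) := by
  refine ⟨mixing_matX hA₁ hp₁ h.leftStochastic fun k => ?_,
    mixing_matY hA₂ hp₂ h.leftStochastic fun k => ?_⟩
  · obtain ⟨l, hl⟩ := h.2.2.1.exists_pos k
    exact ⟨0, k, l, by simp, hl⟩
  · obtain ⟨l, hl⟩ := h.2.2.2.exists_pos k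
    exact ⟨0, k, l, by simp, hl⟩

/-- A single cross-team link suffices, because irreducibility spreads what enters through it to the
whole receiving team. -/
theorem WeakCross.mixing {A₁ : Matrix (Fin K₁) (Fin K₁) ℝ} {A₂ : Matrix (Fin K₂) (Fin K₂) ℝ}
    {C : Matrix (Agent K₁ K₂) (Agent K₁ K₂) ℝ} {p₁ : Fin K₁ → ℝ} {p₂ : Fin K₂ → ℝ}
    (h : WeakCross C) (hA₁ : WithinTeam A₁) (hA₂ : WithinTeam A₂)
    (hp₁ : IsPerronVector A₁ p₁) (hp₂ : IsPerronVector A₂ p₂) :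
    Mixing (matX A₁ C) (Sum.elim p₁ 0) ∧ Mixing (matY A₂ C) (Sum.elim 0 p₂) := by
  obtain ⟨hC, h₁, h₂, ⟨k₁, l₂, hlink₁⟩, ⟨k₂, l₁, hlink₂⟩⟩ := h
  rw [Matrix.isIrreducible_iff_exists_pow_pos h₁.nonneg] at h₁
  rw [Matrix.isIrreducible_iff_exists_pow_pos h₂.nonneg] at h₂
  refine ⟨mixing_matX hA₁ hp₁ hC fun k => ?_, mixing_matY hA₂ hp₂ hC fun k => ?_⟩
  · obtain ⟨r, -, hr⟩ := h₂ k₂ k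
    exact ⟨r, k₂, l₁, hr, hlink₂⟩
  · obtain ⟨r, -, hr⟩ := h₁ k₁ k
    exact ⟨r, k₁, l₂, hr, hlink₁⟩

/-- Strategy update of Team 1 over all agents as a diffusion whose directions are close to the
gradient at the centroid. -/
theorem exists_diffusion_fst {g : StochasticGame K₁ K₂ M₁ M₂} {p₁ : Fin K₁ → ℝ}
    {p₂ : Fin K₂ → ℝ} {L G : ℝ} (A₁ : Matrix (Fin K₁) (Fin K₁) ℝ)
    (A₂ : Matrix (Fin K₂) (Fin K₂) ℝ) {C : Matrix (Agent K₁ K₂) (Agent K₁ K₂) ℝ}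
    (hL1 : LipschitzGrad (g.risk₁ p₁) L) (hL2 : LipschitzGrad (g.risk₂ p₂) L)
    (hG : g.BoundedDisagreement p₁ p₂ G) (hcase : g.ZeroSum p₁ p₂ ∨ C.toBlocks₂₂ = 0) (μ : ℝ)
    (dx : Agent K₁ K₂ → Vec M₁) (dy : Agent K₁ K₂ → Vec M₂) (s : Profile K₁ K₂ M₁ M₂)
    (x : Vec M₁) (y : Vec M₂) {e D : ℝ} (hR : 0 ≤ e + G + L * D) (hL0 : 0 ≤ L)
    (he : ∀ k, ‖dx k - gradX (g.risk k) (s.1 k) (s.2 k)‖ ≤ e)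
    (hD : ∀ k, ‖s.1 k - x‖ + ‖s.2 k - y‖ ≤ D) :
    ∃ v : Agent K₁ K₂ → Vec M₁,
      (stepITC A₁ A₂ C μ dx dy s).1 = combine (matX A₁ C) (s.1 - μ • v) ∧
      ∀ k, ‖v k - gradX (g.risk₁ p₁) x y‖ ≤ e + G + L * D := by
  have hlip : ∀ k, L * (‖s.1 k - x‖ + ‖s.2 k - y‖) ≤ L * D := fun k =>
    mul_le_mul_of_nonneg_left (hD k) hL0
  have hteam : ∀ l, ‖dx (Sum.inl l) - gradX (g.risk₁ p₁) x y‖ ≤ e + G + L * D := fun l =>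
    norm_sub_le_of_three (he _) (hG.1 l _ _).1 ((hL1 _ _ _ _).1.trans (hlip _))
  rcases hcase with hz | h0
  · refine ⟨Sum.elim (fun l => dx (Sum.inl l)) fun l => -dx (Sum.inr l),
      stepITC_fst A₁ A₂ C μ dx dy s _ (fun _ => rfl) (Or.inl fun _ => rfl), ?_⟩
    rintro (l | l)
    · exact hteam l
    · rw [Sum.elim_inr, hz.gradX_eq, ← neg_sub', norm_neg]
      exact norm_sub_le_of_three (he _) (hG.2 l _ _).1 ((hL2 _ _ _ _).1.trans (hlip _))
  -- The directions of Team 2 have no effect here; taking the target gradient itself makes their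
  -- deviation zero.
  · refine ⟨Sum.elim (fun l => dx (Sum.inl l)) fun _ => gradX (g.risk₁ p₁) x y,
      stepITC_fst A₁ A₂ C μ dx dy s _ (fun _ => rfl) (Or.inr h0), ?_⟩
    rintro (l | l)
    · exact hteam l
    · simpa using hR

/-- Strategy update of Team 2 over all agents as a diffusion whose directions are close to the
gradient at the centroid. -/
theorem exists_diffusion_snd {g : StochasticGame K₁ K₂ M₁ M₂} {p₁ : Fin K₁ → ℝ}
    {p₂ : Fin K₂ → ℝ} {L G : ℝ} (A₁ : Matrix (Fin K₁) (Fin K₁) ℝ)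
    (A₂ : Matrix (Fin K₂) (Fin K₂) ℝ) {C : Matrix (Agent K₁ K₂) (Agent K₁ K₂) ℝ}
    (hL1 : LipschitzGrad (g.risk₁ p₁) L) (hL2 : LipschitzGrad (g.risk₂ p₂) L)
    (hG : g.BoundedDisagreement p₁ p₂ G) (hcase : g.ZeroSum p₁ p₂ ∨ C.toBlocks₁₁ = 0) (μ : ℝ)
    (dx : Agent K₁ K₂ → Vec M₁) (dy : Agent K₁ K₂ → Vec M₂) (s : Profile K₁ K₂ M₁ M₂)
    (x : Vec M₁) (y : Vec M₂) {e D : ℝ} (hR : 0 ≤ e + G + L * D) (hL0 : 0 ≤ L)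
    (he : ∀ k, ‖dy k - gradY (g.risk k) (s.1 k) (s.2 k)‖ ≤ e)
    (hD : ∀ k, ‖s.1 k - x‖ + ‖s.2 k - y‖ ≤ D) :
    ∃ v : Agent K₁ K₂ → Vec M₂,
      (stepITC A₁ A₂ C μ dx dy s).2 = combine (matY A₂ C) (s.2 - μ • v) ∧
      ∀ k, ‖v k - gradY (g.risk₂ p₂) x y‖ ≤ e + G + L * D := by
  have hlip : ∀ k, L * (‖s.1 k - x‖ + ‖s.2 k - y‖) ≤ L * D := fun k =>
    mul_le_mul_of_nonneg_left (hD k) hL0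
  have hteam : ∀ l, ‖dy (Sum.inr l) - gradY (g.risk₂ p₂) x y‖ ≤ e + G + L * D := fun l =>
    norm_sub_le_of_three (he _) (hG.2 l _ _).2 ((hL2 _ _ _ _).2.trans (hlip _))
  rcases hcase with hz | h0
  · refine ⟨Sum.elim (fun l => -dy (Sum.inl l)) fun l => dy (Sum.inr l),
      stepITC_snd A₁ A₂ C μ dx dy s _ (fun _ => rfl) (Or.inl fun _ => rfl), ?_⟩
    rintro (l | l)
    · rw [Sum.elim_inl, hz.gradY_eq, ← neg_sub', norm_neg]
      exact norm_sub_le_of_three (he _) (hG.1 l _ _).2 ((hL1 _ _ _ _).2.trans (hlip _))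
    · exact hteam l
  · refine ⟨Sum.elim (fun _ => gradY (g.risk₂ p₂) x y) fun l => dy (Sum.inr l),
      stepITC_snd A₁ A₂ C μ dx dy s _ (fun _ => rfl) (Or.inr h0), ?_⟩
    rintro (l | l)
    · simpa using hR
    · exact hteam l

theorem centroid_eq (p₁ : Fin K₁ → ℝ) (p₂ : Fin K₂ → ℝ) (s : Profile K₁ K₂ M₁ M₂) :
    centroid p₁ p₂ s = WithLp.toLp 2 (∑ k, (Sum.elim p₁ 0 : Agent K₁ K₂ → ℝ) k • s.1 k,
      ∑ k, (Sum.elim 0 p₂ : Agent K₁ K₂ → ℝ) k • s.2 k) := by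
  simp [centroid, Fintype.sum_sum_type]

theorem norm_toLp_prod_le {E F : Type*} [NormedAddCommGroup E] [NormedAddCommGroup F] (a : E)
    (b : F) : ‖WithLp.toLp 2 (a, b)‖ ≤ ‖a‖ + ‖b‖ := by
  rw [WithLp.prod_norm_eq_of_L2]
  refine Real.sqrt_le_iff.2 ⟨by positivity, ?_⟩
  have := mul_nonneg (norm_nonneg a) (norm_nonneg b)
  change ‖a‖ ^ 2 + ‖b‖ ^ 2 ≤ (‖a‖ + ‖b‖) ^ 2
  nlinarith

/-- Size of the disagreement of the agents. -/
noncomputable def disagreement (A₁ : Matrix (Fin K₁) (Fin K₁) ℝ) (A₂ : Matrix (Fin K₂) (Fin K₂) ℝ)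
    (C : Matrix (Agent K₁ K₂) (Agent K₁ K₂) ℝ) (p₁ : Fin K₁ → ℝ) (p₂ : Fin K₂ → ℝ)
    (γ₁ γ₂ : ℝ) (N₁ N₂ : ℕ) (s : Profile K₁ K₂ M₁ M₂) : ℝ :=
  mixNorm (matX A₁ C) γ₁ N₁
      (fun k => s.1 k - ∑ j, (Sum.elim p₁ 0 : Agent K₁ K₂ → ℝ) j • s.1 j) +
    mixNorm (matY A₂ C) γ₂ N₂
      (fun k => s.2 k - ∑ j, (Sum.elim 0 p₂ : Agent K₁ K₂ → ℝ) j • s.2 j)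

theorem disagreement_zero (A₁ : Matrix (Fin K₁) (Fin K₁) ℝ) (A₂ : Matrix (Fin K₂) (Fin K₂) ℝ)
    (C : Matrix (Agent K₁ K₂) (Agent K₁ K₂) ℝ) (p₁ : Fin K₁ → ℝ) (p₂ : Fin K₂ → ℝ)
    (γ₁ γ₂ : ℝ) (N₁ N₂ : ℕ) :
    disagreement A₁ A₂ C p₁ p₂ γ₁ γ₂ N₁ N₂ (0 : Profile K₁ K₂ M₁ M₂) = 0 := by
  simp [disagreement, mixNorm_zero]

/-- One iteration: contraction of the disagreement and perturbed gradient play of the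
centroid. -/
theorem disagreement_stepITC_le {A₁ : Matrix (Fin K₁) (Fin K₁) ℝ}
    {A₂ : Matrix (Fin K₂) (Fin K₂) ℝ} {C : Matrix (Agent K₁ K₂) (Agent K₁ K₂) ℝ}
    {p₁ : Fin K₁ → ℝ} {p₂ : Fin K₂ → ℝ}
    (hX : Mixing (matX A₁ C) (Sum.elim p₁ 0)) (hY : Mixing (matY A₂ C) (Sum.elim 0 p₂))
    {γ₁ γ₂ : ℝ} {N₁ N₂ : ℕ} (hγ₁ : 0 < γ₁) (hγ₂ : 0 < γ₂) (hγ₁' : γ₁ ≤ 1) (hγ₂' : γ₂ ≤ 1)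
    (hN₁ : 0 < N₁) (hN₂ : 0 < N₂)
    (hcX : ∀ u : Agent K₁ K₂ → Vec M₁,
      ∑ k, (Sum.elim p₁ 0 : Agent K₁ K₂ → ℝ) k • u k = 0 →
      mixNorm (matX A₁ C) γ₁ N₁ (combine (matX A₁ C) u) ≤ γ₁ * mixNorm (matX A₁ C) γ₁ N₁ u)
    (hcY : ∀ u : Agent K₁ K₂ → Vec M₂,
      ∑ k, (Sum.elim 0 p₂ : Agent K₁ K₂ → ℝ) k • u k = 0 →
      mixNorm (matY A₂ C) γ₂ N₂ (combine (matY A₂ C) u) ≤ γ₂ * mixNorm (matY A₂ C) γ₂ N₂ u)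
    {g : StochasticGame K₁ K₂ M₁ M₂} {L G : ℝ}
    (hL1 : LipschitzGrad (g.risk₁ p₁) L) (hL2 : LipschitzGrad (g.risk₂ p₂) L)
    (hG : g.BoundedDisagreement p₁ p₂ G)
    (hcase : g.ZeroSum p₁ p₂ ∨ C.toBlocks₁₁ = 0 ∧ C.toBlocks₂₂ = 0)
    {μ : ℝ} (hμ : 0 ≤ μ) (hL0 : 0 ≤ L)
    (dx : Agent K₁ K₂ → Vec M₁) (dy : Agent K₁ K₂ → Vec M₂) (s : Profile K₁ K₂ M₁ M₂)
    {e : ℝ} (hR : 0 ≤ e + |G|) (hex : ∀ k, ‖dx k - gradX (g.risk k) (s.1 k) (s.2 k)‖ ≤ e)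
    (hey : ∀ k, ‖dy k - gradY (g.risk k) (s.1 k) (s.2 k)‖ ≤ e) :
    disagreement A₁ A₂ C p₁ p₂ γ₁ γ₂ N₁ N₂ (stepITC A₁ A₂ C μ dx dy s)
        ≤ max γ₁ γ₂ * disagreement A₁ A₂ C p₁ p₂ γ₁ γ₂ N₁ N₂ s
          + μ * (2 * (∑ j ∈ Finset.range N₁, γ₁⁻¹ ^ j + ∑ j ∈ Finset.range N₂, γ₂⁻¹ ^ j) *
            (e + |G| + L * disagreement A₁ A₂ C p₁ p₂ γ₁ γ₂ N₁ N₂ s)) ∧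
    ‖centroid p₁ p₂ (stepITC A₁ A₂ C μ dx dy s) - centroid p₁ p₂ s
        + μ • g.gradMap p₁ p₂ (centroid p₁ p₂ s)‖
      ≤ μ * (2 * (e + |G| + L * disagreement A₁ A₂ C p₁ p₂ γ₁ γ₂ N₁ N₂ s)) := by
  have hG' : g.BoundedDisagreement p₁ p₂ |G| :=
    ⟨fun k x y => ⟨((hG.1 k x y).1).trans (le_abs_self G), ((hG.1 k x y).2).trans (le_abs_self G)⟩,
      fun k x y => ⟨((hG.2 k x y).1).trans (le_abs_self G), ((hG.2 k x y).2).trans (le_abs_self G)⟩⟩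
  set x := ∑ j, (Sum.elim p₁ 0 : Agent K₁ K₂ → ℝ) j • s.1 j with hx
  set y := ∑ j, (Sum.elim 0 p₂ : Agent K₁ K₂ → ℝ) j • s.2 j with hy
  have hDdef : disagreement A₁ A₂ C p₁ p₂ γ₁ γ₂ N₁ N₂ s =
    mixNorm (matX A₁ C) γ₁ N₁ (fun k => s.1 k - x) +
      mixNorm (matY A₂ C) γ₂ N₂ (fun k => s.2 k - y) := rfl
  set DX := mixNorm (matX A₁ C) γ₁ N₁ (fun k => s.1 k - x) with hDX
  set DY := mixNorm (matY A₂ C) γ₂ N₂ (fun k => s.2 k - y) with hDY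
  have hnX := norm_le_mixNorm (matX A₁ C) hγ₁ hN₁ (fun k => s.1 k - x)
  have hnY := norm_le_mixNorm (matY A₂ C) hγ₂ hN₂ (fun k => s.2 k - y)
  have hDX0 : 0 ≤ DX := (norm_nonneg _).trans hnX
  have hDY0 : 0 ≤ DY := (norm_nonneg _).trans hnY
  have hD : ∀ k, ‖s.1 k - x‖ + ‖s.2 k - y‖ ≤ DX + DY := fun k =>
    add_le_add ((norm_le_pi_norm (fun k => s.1 k - x) k).trans hnX)
      ((norm_le_pi_norm (fun k => s.2 k - y) k).trans hnY)
  have hR' : 0 ≤ e + |G| + L * (DX + DY) := by positivity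
  obtain ⟨v, hv, hvR⟩ := exists_diffusion_fst A₁ A₂ hL1 hL2 hG' (hcase.imp_right And.right) μ dx dy
    s x y hR' hL0 hex hD
  obtain ⟨w, hw, hwR⟩ := exists_diffusion_snd A₁ A₂ hL1 hL2 hG' (hcase.imp_right And.left) μ dx dy
    s x y hR' hL0 hey hD
  rw [hDdef]
  set R := e + |G| + L * (DX + DY) with hRdef
  constructor
  · have h1 := hX.diffusion_disagreement hγ₁ hγ₁' hcX hμ s.1 v _ hvR hR'
    have h2 := hY.diffusion_disagreement hγ₂ hγ₂' hcY hμ s.2 w _ hwR hR'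
    rw [← hv, ← hx, ← hDX] at h1
    rw [← hw, ← hy, ← hDY] at h2
    have h3 : γ₁ * DX ≤ max γ₁ γ₂ * DX := by gcongr; exact le_max_left _ _
    have h4 : γ₂ * DY ≤ max γ₁ γ₂ * DY := by gcongr; exact le_max_right _ _
    rw [disagreement]
    calc _ ≤ _ := add_le_add h1 h2
      _ ≤ _ := by linarith
  · have h1 := hX.diffusion_mean μ s.1 v
    have h2 := hY.diffusion_mean μ s.2 w
    rw [← hv, ← hx] at h1
    rw [← hw, ← hy] at h2
    -- The perturbation is `-μ` times the gap between the weighted mean direction and the gradient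
    -- at the centroid, so each component is at most `μ R`.
    have h3 : centroid p₁ p₂ (stepITC A₁ A₂ C μ dx dy s) - centroid p₁ p₂ s
        + μ • g.gradMap p₁ p₂ (centroid p₁ p₂ s)
        = WithLp.toLp 2
          (-(μ • (∑ k, (Sum.elim p₁ 0 : Agent K₁ K₂ → ℝ) k • v k - gradX (g.risk₁ p₁) x y)),
            -(μ • (∑ k, (Sum.elim 0 p₂ : Agent K₁ K₂ → ℝ) k • w k
              - gradY (g.risk₂ p₂) x y))) := by
      rw [centroid_eq, centroid_eq, h1, h2, ← hx, ← hy, StochasticGame.gradMap, ← WithLp.toLp_smul,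
        ← WithLp.toLp_sub, ← WithLp.toLp_add]
      congr 1
      ext1
      · simp only [Prod.fst_add, Prod.fst_sub, smul_sub]
        abel
      · simp only [Prod.snd_add, Prod.snd_sub, smul_sub]
        abel
    rw [h3]
    refine (norm_toLp_prod_le _ _).trans ?_
    rw [norm_neg, norm_neg, norm_smul, norm_smul, Real.norm_of_nonneg hμ, ← mul_add]
    gcongr
    linarith [hX.norm_mean_sub_le hvR, hY.norm_mean_sub_le hwR]

end Diffusion

/-! ### Measurability and mean square estimates -/

section Noise

variable {K₁ K₂ M₁ M₂ : ℕ} {Ω : Type*}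

theorem measurable_history (s : ℕ → Ω → Profile K₁ K₂ M₁ M₂) (i : ℕ) (k : Agent K₁ K₂) :
    (Measurable[history s i] fun ω => (s i ω).1 k) ∧
      Measurable[history s i] fun ω => (s i ω).2 k := by
  have h : MeasurableSpace.comap (fun ω => (s i ω).1 k) inferInstance ⊔
      MeasurableSpace.comap (fun ω => (s i ω).2 k) inferInstance ≤ history s i :=
    le_iSup₂_of_le i le_rfl (le_iSup_of_le k le_rfl)
  exact ⟨measurable_iff_comap_le.2 (le_sup_left.trans h),
    measurable_iff_comap_le.2 (le_sup_right.trans h)⟩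

theorem integral_le_of_condExp_le {m m₀ : MeasurableSpace Ω} {P : Measure Ω}
    [IsProbabilityMeasure P] (hm : m ≤ m₀) {f : Ω → ℝ} {a : ℝ}
    (h : P[f | m] ≤ᵐ[P] fun _ => a) : ∫ ω, f ω ∂P ≤ a := by
  rw [← integral_condExp hm]
  calc _ ≤ ∫ _, a ∂P := integral_mono_ae integrable_condExp (integrable_const a) h
    _ = a := by simp

variable [MeasurableSpace Ω]

theorem measurable_sum_smul {ι : Type*} [Fintype ι] {M : ℕ} (a : ι → ℝ) {X : ι → Ω → Vec M}
    (hX : ∀ l, Measurable (X l)) : Measurable fun ω => ∑ l, a l • X l ω :=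
  Finset.measurable_fun_sum _ fun l _ => (hX l).const_smul (a l)

theorem measurable_iterates_stepITC (A₁ : Matrix (Fin K₁) (Fin K₁) ℝ)
    (A₂ : Matrix (Fin K₂) (Fin K₂) ℝ) (C : Matrix (Agent K₁ K₂) (Agent K₁ K₂) ℝ) (μ : ℝ)
    (O : StochasticGradient K₁ K₂ M₁ M₂ Ω) (i : ℕ) :
    (∀ k, Measurable fun ω => (iterates (stepITC A₁ A₂ C μ) O i ω).1 k) ∧
      ∀ k, Measurable fun ω => (iterates (stepITC A₁ A₂ C μ) O i ω).2 k := by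
  induction i with
  | zero => exact ⟨fun k => measurable_const, fun k => measurable_const⟩
  | succ i ih =>
    obtain ⟨h₁, h₂⟩ := ih
    have hx : ∀ k, Measurable fun ω => O.gx i k ((iterates (stepITC A₁ A₂ C μ) O i ω).1 k)
        ((iterates (stepITC A₁ A₂ C μ) O i ω).2 k) ω := fun k =>
      (O.measurable_gx i k).comp (((h₁ k).prodMk (h₂ k)).prodMk measurable_id)
    have hy : ∀ k, Measurable fun ω => O.gy i k ((iterates (stepITC A₁ A₂ C μ) O i ω).1 k)
        ((iterates (stepITC A₁ A₂ C μ) O i ω).2 k) ω := fun k =>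
      (O.measurable_gy i k).comp (((h₁ k).prodMk (h₂ k)).prodMk measurable_id)
    constructor <;> rintro (k | k) <;>
      simp only [iterates, stepITC, adaptCombine₁, adaptCombine₂, Sum.elim_inl, Sum.elim_inr]
    · exact measurable_sum_smul _ fun l => (h₁ _).sub ((hx _).const_smul μ)
    · exact (measurable_sum_smul _ fun l => measurable_sum_smul _ fun j =>
        (h₁ _).sub ((hx _).const_smul μ)).add
        (measurable_sum_smul _ fun l => (h₁ _).add ((hx _).const_smul μ))
    · exact (measurable_sum_smul _ fun l => measurable_sum_smul _ fun j =>
        (h₂ _).sub ((hy _).const_smul μ)).add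
        (measurable_sum_smul _ fun l => (h₂ _).add ((hy _).const_smul μ))
    · exact measurable_sum_smul _ fun l => (h₂ _).sub ((hy _).const_smul μ)

theorem history_le {s : ℕ → Ω → Profile K₁ K₂ M₁ M₂}
    (hs : ∀ i, (∀ k, Measurable fun ω => (s i ω).1 k) ∧ ∀ k, Measurable fun ω => (s i ω).2 k)
    (i : ℕ) : history s i ≤ ‹MeasurableSpace Ω› :=
  iSup₂_le fun j _ => iSup_le fun k =>
    sup_le ((hs j).1 k).comap_le ((hs j).2 k).comap_le

/-- Mean square gradient noise at the current iterates. -/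
theorem GradientNoise.integral_le {P : Measure Ω} [IsProbabilityMeasure P]
    {g : StochasticGame K₁ K₂ M₁ M₂} {O : StochasticGradient K₁ K₂ M₁ M₂ Ω}
    {s : ℕ → Ω → Profile K₁ K₂ M₁ M₂} {σ : ℝ} (h : GradientNoise P g O s σ)
    (hs : ∀ i, (∀ k, Measurable fun ω => (s i ω).1 k) ∧ ∀ k, Measurable fun ω => (s i ω).2 k)
    (i : ℕ) (k : Agent K₁ K₂) :
    (Integrable (fun ω => ‖O.gx i k ((s i ω).1 k) ((s i ω).2 k) ω
        - gradX (g.risk k) ((s i ω).1 k) ((s i ω).2 k)‖ ^ 2) P ∧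
      ∫ ω, ‖O.gx i k ((s i ω).1 k) ((s i ω).2 k) ω
        - gradX (g.risk k) ((s i ω).1 k) ((s i ω).2 k)‖ ^ 2 ∂P ≤ σ ^ 2) ∧
    (Integrable (fun ω => ‖O.gy i k ((s i ω).1 k) ((s i ω).2 k) ω
        - gradY (g.risk k) ((s i ω).1 k) ((s i ω).2 k)‖ ^ 2) P ∧
      ∫ ω, ‖O.gy i k ((s i ω).1 k) ((s i ω).2 k) ω
        - gradY (g.risk k) ((s i ω).1 k) ((s i ω).2 k)‖ ^ 2 ∂P ≤ σ ^ 2) := by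
  obtain ⟨hx, hy⟩ := h i k _ _ (measurable_history s i k).1 (measurable_history s i k).2
  exact ⟨⟨hx.1, integral_le_of_condExp_le (history_le hs i) hx.2.2⟩,
    ⟨hy.1, integral_le_of_condExp_le (history_le hs i) hy.2.2⟩⟩

/-- Mean square bound for a nonnegative process with a contractive recursion. -/
theorem exists_integrable_sq_le {P : Measure Ω} [IsProbabilityMeasure P] {D b Q : ℕ → Ω → ℝ}
    {ρ β : ℝ} (hρ0 : 0 ≤ ρ) (hρ : ρ < 1) (hD0 : ∀ ω, D 0 ω = 0) (hD : ∀ i ω, 0 ≤ D i ω)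
    (hrec : ∀ i ω, D (i + 1) ω ≤ ρ * D i ω + b i ω) (hb : ∀ i ω, b i ω ^ 2 ≤ Q i ω)
    (hQ : ∀ i, Integrable (Q i) P) (hQβ : ∀ i, ∫ ω, Q i ω ∂P ≤ β) (hβ : 0 ≤ β) (i : ℕ) :
    ∃ U : Ω → ℝ, Integrable U P ∧ (∀ ω, D i ω ^ 2 ≤ U ω) ∧ ∫ ω, U ω ∂P ≤ β / (1 - ρ) ^ 2 := by
  have h1 : 0 < 1 - ρ := by linarith
  induction i with
  | zero => exact ⟨fun _ => 0, integrable_zero _ _ _, by simp [hD0], by simp; positivity⟩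
  | succ i ih =>
    obtain ⟨U, hU, hDU, hUβ⟩ := ih
    -- Convexity of the square, applied to `ρ D + (1 - ρ) (b / (1 - ρ))`. The bound `β / (1 - ρ) ^
    -- 2` is the fixed point of the resulting recursion `m ↦ ρ m + β / (1 - ρ)`. Working with a
    -- majorant `U` avoids measurability of `D`.
    refine ⟨fun ω => ρ * U ω + (1 - ρ)⁻¹ * Q i ω, (hU.const_mul _).add ((hQ i).const_mul _),
      fun ω => ?_, ?_⟩
    · have h2 : D (i + 1) ω ^ 2 ≤ (ρ * D i ω + b i ω) ^ 2 :=
        pow_le_pow_left₀ (hD _ _) (hrec i ω) 2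
      have h3 : (ρ * D i ω + b i ω) ^ 2 ≤ ρ * D i ω ^ 2 + (1 - ρ)⁻¹ * b i ω ^ 2 := by
        have h4 : ρ * D i ω ^ 2 + (1 - ρ)⁻¹ * b i ω ^ 2 - (ρ * D i ω + b i ω) ^ 2
            = ρ * (1 - ρ)⁻¹ * ((1 - ρ) * D i ω - b i ω) ^ 2 := by
          field_simp
          ring
        have h5 : 0 ≤ ρ * (1 - ρ)⁻¹ * ((1 - ρ) * D i ω - b i ω) ^ 2 := by positivity
        linarith
      calc _ ≤ _ := h2.trans h3
        _ ≤ ρ * U ω + (1 - ρ)⁻¹ * Q i ω := by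
          gcongr
          · exact hDU ω
          · exact hb i ω
    · rw [integral_add (hU.const_mul _) ((hQ i).const_mul _), integral_const_mul,
        integral_const_mul]
      calc _ ≤ ρ * (β / (1 - ρ) ^ 2) + (1 - ρ)⁻¹ * β := by gcongr; exact hQβ i
        _ = _ := by field_simp; ring

theorem measurable_gradMap {g : StochasticGame K₁ K₂ M₁ M₂} {p₁ : Fin K₁ → ℝ} {p₂ : Fin K₂ → ℝ}
    {L : ℝ} (hL1 : LipschitzGrad (g.risk₁ p₁) L) (hL2 : LipschitzGrad (g.risk₂ p₂) L) :
    Measurable (g.gradMap p₁ p₂) := by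
  have h : Continuous (g.gradMap p₁ p₂) := by
    have h0 : Continuous fun z : WithLp 2 (Vec M₁ × Vec M₂) => (z.fst, z.snd) := by fun_prop
    exact (WithLp.prod_continuous_toLp 2 _ _).comp
      ((hL1.continuous_gradX.comp h0).prodMk (hL2.continuous_gradY.comp h0))
  exact h.measurable

theorem measurable_centroid (p₁ : Fin K₁ → ℝ) (p₂ : Fin K₂ → ℝ) {s : Ω → Profile K₁ K₂ M₁ M₂}
    (h₁ : ∀ k, Measurable fun ω => (s ω).1 k) (h₂ : ∀ k, Measurable fun ω => (s ω).2 k) :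
    Measurable fun ω => centroid p₁ p₂ (s ω) := by
  refine (WithLp.prod_continuous_toLp 2 (Vec M₁) (Vec M₂)).measurable.comp (Measurable.prodMk ?_ ?_)
  · exact measurable_sum_smul p₁ fun k => h₁ (Sum.inl k)
  · exact measurable_sum_smul p₂ fun k => h₂ (Sum.inr k)

end Noise

/-- Perturbed gradient play with mean square perturbation of order `μ²` at all times. -/
theorem exists_perturbedGradientPlay {K₁ K₂ : ℕ} {A₁ : Matrix (Fin K₁) (Fin K₁) ℝ}
    {A₂ : Matrix (Fin K₂) (Fin K₂) ℝ} {C : Matrix (Agent K₁ K₂) (Agent K₁ K₂) ℝ}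
    {p₁ : Fin K₁ → ℝ} {p₂ : Fin K₂ → ℝ} (hp₁ : IsPerronVector A₁ p₁) (hp₂ : IsPerronVector A₂ p₂)
    (hX : Mixing (matX A₁ C) (Sum.elim p₁ 0)) (hY : Mixing (matY A₂ C) (Sum.elim 0 p₂)) :
    ∃ γ : ℝ, 0 < γ ∧ γ < 1 ∧ ∀ L G σ : ℝ, ∃ μ₀ : ℝ, 0 < μ₀ ∧ ∃ B : ℝ,
      ∀ (M₁ M₂ : ℕ) (g : StochasticGame K₁ K₂ M₁ M₂),
        (g.ZeroSum p₁ p₂ ∨ C.toBlocks₁₁ = 0 ∧ C.toBlocks₂₂ = 0) → g.LipschitzGradients L →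
        g.BoundedDisagreement p₁ p₂ G →
      ∀ μ : ℝ, 0 < μ → μ < μ₀ →
      ∀ (Ω : Type*) [MeasurableSpace Ω] (P : Measure Ω) [IsProbabilityMeasure P]
        (O : StochasticGradient K₁ K₂ M₁ M₂ Ω),
        GradientNoise P g O (iterates (stepITC A₁ A₂ C μ) O) σ →
        ∀ i₀ : ℝ, PerturbedGradientPlay P g p₁ p₂ (iterates (stepITC A₁ A₂ C μ) O) μ i₀
          (B * μ ^ 2) := by
  obtain ⟨γ₁, N₁, hγ₁, hγ₁', hN₁, hcX⟩ := hX.exists_contraction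
  obtain ⟨γ₂, N₂, hγ₂, hγ₂', hN₂, hcY⟩ := hY.exists_contraction
  set γ := max γ₁ γ₂ with hγdef
  have hγ0 : 0 < γ := lt_max_of_lt_left hγ₁
  have hγ1 : γ < 1 := max_lt hγ₁' hγ₂'
  set K := 2 * (∑ j ∈ Finset.range N₁, γ₁⁻¹ ^ j + ∑ j ∈ Finset.range N₂, γ₂⁻¹ ^ j) with hKdef
  have hK0 : 0 ≤ K := by positivity
  refine ⟨γ, hγ0, hγ1, fun L G σ => ?_⟩
  set ρ := (1 + γ) / 2 with hρdef
  have hρ0 : 0 ≤ ρ := by positivity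
  have hρ1 : ρ < 1 := by rw [hρdef]; linarith
  set n : ℝ := (Fintype.card (Agent K₁ K₂) : ℝ) with hn
  set β := 8 * n ^ 2 * σ ^ 2 + 2 * G ^ 2 with hβdef
  have hβ0 : 0 ≤ β := by positivity
  -- The second term of the minimum forces `μ K |L| ≤ (1 - γ) / 2`, so that the perturbed factor
  -- stays below the midpoint `ρ` of `γ` and `1`; the `+ 1` keeps the denominator positive.
  refine ⟨min 1 ((1 - γ) / (2 * (K * |L| + 1))), lt_min one_pos (div_pos (by linarith)
    (by positivity)), 8 * (β + L ^ 2 * (K ^ 2 * β / (1 - ρ) ^ 2)), ?_⟩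
  intro M₁ M₂ g hcase hL hG μ hμ hμ₀ Ω _ P _ O hnoise i₀
  have hμ1 : μ ≤ 1 := (hμ₀.trans_le (min_le_left _ _)).le
  have hμγ : γ + μ * K * |L| ≤ ρ := by
    have h1 := hμ₀.trans_le (min_le_right _ _)
    rw [lt_div_iff₀ (by positivity)] at h1
    rw [hρdef]
    linarith
  have hL1 : LipschitzGrad (g.risk₁ p₁) |L| := (hL.risk₁ hp₁.2.1 hp₁.2.2).mono (le_abs_self L)
  have hL2 : LipschitzGrad (g.risk₂ p₂) |L| := (hL.risk₂ hp₂.2.1 hp₂.2.2).mono (le_abs_self L)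
  set s := iterates (stepITC A₁ A₂ C μ) O with hs
  have hsm := measurable_iterates_stepITC A₁ A₂ C μ O
  rw [← hs] at hsm
  set ex : ℕ → Agent K₁ K₂ → Ω → ℝ := fun i k ω => ‖O.gx i k ((s i ω).1 k) ((s i ω).2 k) ω
        - gradX (g.risk k) ((s i ω).1 k) ((s i ω).2 k)‖ with hex
  set ey : ℕ → Agent K₁ K₂ → Ω → ℝ := fun i k ω => ‖O.gy i k ((s i ω).1 k) ((s i ω).2 k) ω
        - gradY (g.risk k) ((s i ω).1 k) ((s i ω).2 k)‖ with hey
  have hint := fun i k => hnoise.integral_le hsm i k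
  have hex0 : ∀ i k ω, 0 ≤ ex i k ω := fun i k ω => norm_nonneg _
  have hey0 : ∀ i k ω, 0 ≤ ey i k ω := fun i k ω => norm_nonneg _
  set e : ℕ → Ω → ℝ := fun i ω => ∑ k, (ex i k ω + ey i k ω) with he
  have he0 : ∀ i ω, 0 ≤ e i ω := fun i ω =>
    Finset.sum_nonneg fun k _ => add_nonneg (hex0 i k ω) (hey0 i k ω)
  have hle : ∀ i k ω, ex i k ω + ey i k ω ≤ e i ω := fun i k ω =>
    Finset.single_le_sum (f := fun k => ex i k ω + ey i k ω)
      (fun k _ => add_nonneg (hex0 i k ω) (hey0 i k ω)) (Finset.mem_univ k)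
  -- An integrable majorant of `(e + |G|) ^ 2`, by Cauchy–Schwarz over the `n` agents and two uses
  -- of `(a + b) ^ 2 ≤ 2 (a ^ 2 + b ^ 2)`. The noise bound `σ ^ 2` for each gradient gives its mean
  -- at most `β`.
  set Q : ℕ → Ω → ℝ := fun i ω => 4 * n * ∑ k, (ex i k ω ^ 2 + ey i k ω ^ 2) + 2 * G ^ 2 with hQdef
  have hkint : ∀ i k, Integrable (fun ω => ex i k ω ^ 2 + ey i k ω ^ 2) P := fun i k =>
    (hint i k).1.1.add (hint i k).2.1
  have hsumint : ∀ i, Integrable (fun ω => ∑ k, (ex i k ω ^ 2 + ey i k ω ^ 2)) P := fun i =>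
    integrable_finsetSum _ fun k _ => hkint i k
  have hQint : ∀ i, Integrable (Q i) P := fun i =>
    ((hsumint i).const_mul _).add (integrable_const _)
  have hQβ : ∀ i, ∫ ω, Q i ω ∂P ≤ β := fun i => by
    rw [hQdef, integral_add ((hsumint i).const_mul _) (integrable_const _), integral_const_mul,
      integral_finsetSum _ fun k _ => hkint i k]
    have h1 : ∑ k, ∫ ω, (ex i k ω ^ 2 + ey i k ω ^ 2) ∂P ≤ n * (2 * σ ^ 2) := by
      have h2 : ∀ k ∈ Finset.univ, ∫ ω, (ex i k ω ^ 2 + ey i k ω ^ 2) ∂P ≤ 2 * σ ^ 2 := fun k _ => by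
        rw [integral_add (hint i k).1.1 (hint i k).2.1]
        linarith [(hint i k).1.2, (hint i k).2.2]
      simpa [hn] using Finset.sum_le_sum h2
    have h3 : 4 * n * ∑ k, ∫ ω, (ex i k ω ^ 2 + ey i k ω ^ 2) ∂P ≤ 4 * n * (n * (2 * σ ^ 2)) := by
      gcongr
    simp only [integral_const, probReal_univ, one_smul]
    rw [hβdef]
    linarith
  have heQ : ∀ i ω, (e i ω + |G|) ^ 2 ≤ Q i ω := fun i ω => by
    have h1 : e i ω ^ 2 ≤ n * ∑ k, (ex i k ω + ey i k ω) ^ 2 := by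
      have := sq_sum_le_card_mul_sum_sq (s := Finset.univ) (f := fun k => ex i k ω + ey i k ω)
      rwa [Finset.card_univ] at this
    have h2 : ∑ k, (ex i k ω + ey i k ω) ^ 2 ≤ 2 * ∑ k, (ex i k ω ^ 2 + ey i k ω ^ 2) := by
      rw [Finset.mul_sum]
      refine Finset.sum_le_sum fun k _ => ?_
      exact add_sq_le
    have h3 : n * ∑ k, (ex i k ω + ey i k ω) ^ 2
        ≤ n * (2 * ∑ k, (ex i k ω ^ 2 + ey i k ω ^ 2)) := by gcongr
    have h4 : (e i ω + |G|) ^ 2 ≤ 2 * (e i ω ^ 2 + |G| ^ 2) := add_sq_le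
    rw [sq_abs] at h4
    simp only [hQdef]
    linarith
  set D : ℕ → Ω → ℝ := fun i ω => disagreement A₁ A₂ C p₁ p₂ γ₁ γ₂ N₁ N₂ (s i ω) with hDdef
  have hD0 : ∀ i ω, 0 ≤ D i ω := fun i ω =>
    add_nonneg (mixNorm_nonneg _ hγ₁.le _ _) (mixNorm_nonneg _ hγ₂.le _ _)
  have hstep := fun i ω => disagreement_stepITC_le hX hY hγ₁ hγ₂ hγ₁'.le hγ₂'.le hN₁ hN₂
    (hcX (Vec M₁)) (hcY (Vec M₂)) hL1 hL2 hG hcase hμ.le (abs_nonneg L)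
    (fun k => O.gx i k ((s i ω).1 k) ((s i ω).2 k) ω)
    (fun k => O.gy i k ((s i ω).1 k) ((s i ω).2 k) ω) (s i ω)
    (add_nonneg (he0 i ω) (abs_nonneg G))
    (fun k => (le_add_of_nonneg_right (hey0 i k ω)).trans (hle i k ω))
    (fun k => (le_add_of_nonneg_left (hex0 i k ω)).trans (hle i k ω))
  have hmoment := exists_integrable_sq_le (P := P) (D := D)
    (b := fun i ω => μ * (K * (e i ω + |G|))) (Q := fun i ω => K ^ 2 * Q i ω) (β := K ^ 2 * β)
    hρ0 hρ1
    (fun ω => disagreement_zero ..)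
    hD0
    (fun i ω => by
      have h1 : D (i + 1) ω ≤ γ * D i ω + μ * (K * (e i ω + |G| + |L| * D i ω)) := (hstep i ω).1
      have h2 : (γ + μ * K * |L|) * D i ω ≤ ρ * D i ω :=
        mul_le_mul_of_nonneg_right hμγ (hD0 i ω)
      linarith)
    -- The factor `μ ^ 2 ≤ 1` is discarded: a bound on `D` uniform in time and in `μ` is enough.
    (fun i ω => by
      have h1 : (μ * (K * (e i ω + |G|))) ^ 2 = μ ^ 2 * (K ^ 2 * (e i ω + |G|) ^ 2) := by ring
      have h2 : μ ^ 2 ≤ 1 := pow_le_one₀ hμ.le hμ1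
      rw [h1]
      calc _ ≤ 1 * (K ^ 2 * Q i ω) := by gcongr; exact heQ i ω
        _ = _ := one_mul _)
    (fun i => (hQint i).const_mul _)
    (fun i => by
      rw [integral_const_mul]
      exact mul_le_mul_of_nonneg_left (hQβ i) (sq_nonneg K))
    (mul_nonneg (sq_nonneg K) hβ0)
  refine ⟨fun i ω => centroid p₁ p₂ (s (i + 1) ω) - centroid p₁ p₂ (s i ω)
    + μ • g.gradMap p₁ p₂ (centroid p₁ p₂ (s i ω)), fun i ω => by module, fun i _ => ?_⟩
  obtain ⟨U, hU, hDU, hUβ⟩ := hmoment i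
  set d : Ω → WithLp 2 (Vec M₁ × Vec M₂) := fun ω => centroid p₁ p₂ (s (i + 1) ω)
    - centroid p₁ p₂ (s i ω) + μ • g.gradMap p₁ p₂ (centroid p₁ p₂ (s i ω)) with hd
  have hcm := fun i => measurable_centroid p₁ p₂ (hsm i).1 (hsm i).2
  have hdm : Measurable d := ((hcm (i + 1)).sub (hcm i)).add
    (((measurable_gradMap hL1 hL2).comp (hcm i)).const_smul μ)
  have hdV : ∀ ω, ‖d ω‖ ^ 2 ≤ μ ^ 2 * (8 * (Q i ω + L ^ 2 * U ω)) := fun ω => by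
    have h1 : ‖d ω‖ ≤ μ * (2 * (e i ω + |G| + |L| * D i ω)) := (hstep i ω).2
    have h2 := pow_le_pow_left₀ (norm_nonneg _) h1 2
    have h3 : (e i ω + |G| + |L| * D i ω) ^ 2 ≤ 2 * ((e i ω + |G|) ^ 2 + (|L| * D i ω) ^ 2) :=
      add_sq_le
    rw [mul_pow |L|, sq_abs] at h3
    have h4 : L ^ 2 * D i ω ^ 2 ≤ L ^ 2 * U ω := mul_le_mul_of_nonneg_left (hDU ω) (sq_nonneg L)
    calc _ ≤ _ := h2
      _ = μ ^ 2 * (4 * (e i ω + |G| + |L| * D i ω) ^ 2) := by ring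
      _ ≤ _ := by
        refine mul_le_mul_of_nonneg_left ?_ (sq_nonneg μ)
        linarith [heQ i ω]
  have hVint : Integrable (fun ω => μ ^ 2 * (8 * (Q i ω + L ^ 2 * U ω))) P :=
    (((hQint i).add (hU.const_mul _)).const_mul _).const_mul _
  have hdint : Integrable (fun ω => ‖d ω‖ ^ 2) P :=
    hVint.mono' (hdm.norm.pow_const 2).aestronglyMeasurable
      (Filter.Eventually.of_forall fun ω => by
        rw [Real.norm_of_nonneg (sq_nonneg _)]; exact hdV ω)
  refine ⟨hdint, (integral_mono hdint hVint hdV).trans ?_⟩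
  rw [integral_const_mul, integral_const_mul, integral_add (hQint i) (hU.const_mul _),
    integral_const_mul, mul_comm]
  gcongr
  exact hQβ i

end CompetingNetworks

theorem lemma2 {K₁ K₂ : ℕ}
    (A₁ : Matrix (Fin K₁) (Fin K₁) ℝ) (A₂ : Matrix (Fin K₂) (Fin K₂) ℝ)
    (C : Matrix (CompetingNetworks.Agent K₁ K₂) (CompetingNetworks.Agent K₁ K₂) ℝ)
    (hA₁ : CompetingNetworks.WithinTeam A₁) (hA₂ : CompetingNetworks.WithinTeam A₂)
    (p₁ : Fin K₁ → ℝ) (p₂ : Fin K₂ → ℝ)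
    (hp₁ : CompetingNetworks.IsPerronVector A₁ p₁)
    (hp₂ : CompetingNetworks.IsPerronVector A₂ p₂) :
    -- ATC-ITC: zero-sum objectives, weak cross-team subgraph
    (CompetingNetworks.WeakCross C →
      ∃ α : ℝ, 0 < α ∧ α < 1 ∧ ∀ L G σ : ℝ, ∃ μ₀ : ℝ, 0 < μ₀ ∧ ∀ c : ℝ, 0 < c → ∃ B : ℝ,
        ∀ (M₁ M₂ : ℕ) (g : CompetingNetworks.StochasticGame K₁ K₂ M₁ M₂),
          g.ZeroSum p₁ p₂ → g.LipschitzGradients L → g.BoundedDisagreement p₁ p₂ G →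
        ∀ μ : ℝ, 0 < μ → μ < μ₀ →
        ∀ (Ω : Type*) [MeasurableSpace Ω] (P : MeasureTheory.Measure Ω)
          [MeasureTheory.IsProbabilityMeasure P]
          (O : CompetingNetworks.StochasticGradient K₁ K₂ M₁ M₂ Ω),
          CompetingNetworks.GradientNoise P g O
            (CompetingNetworks.iterates (CompetingNetworks.stepITC A₁ A₂ C μ) O) σ →
          CompetingNetworks.PerturbedGradientPlay P g p₁ p₂
            (CompetingNetworks.iterates (CompetingNetworks.stepITC A₁ A₂ C μ) O)
            μ (Real.log (c * μ ^ 2) / Real.log α) (B * μ ^ 2)) ∧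
    -- ATC-C: general objectives, strong cross-team subgraph
    (CompetingNetworks.StrongCross C →
      ∃ β : ℝ, 0 < β ∧ β < 1 ∧ ∀ L G σ : ℝ, ∃ μ₀ : ℝ, 0 < μ₀ ∧ ∀ c : ℝ, 0 < c → ∃ B : ℝ,
        ∀ (M₁ M₂ : ℕ) (g : CompetingNetworks.StochasticGame K₁ K₂ M₁ M₂),
          g.LipschitzGradients L → g.BoundedDisagreement p₁ p₂ G →
        ∀ μ : ℝ, 0 < μ → μ < μ₀ →
        ∀ (Ω : Type*) [MeasurableSpace Ω] (P : MeasureTheory.Measure Ω)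
          [MeasureTheory.IsProbabilityMeasure P]
          (O : CompetingNetworks.StochasticGradient K₁ K₂ M₁ M₂ Ω),
          CompetingNetworks.GradientNoise P g O
            (CompetingNetworks.iterates (CompetingNetworks.stepC A₁ A₂ C μ) O) σ →
          CompetingNetworks.PerturbedGradientPlay P g p₁ p₂
            (CompetingNetworks.iterates (CompetingNetworks.stepC A₁ A₂ C μ) O)
            μ (Real.log (c * μ ^ 2) / Real.log β) (B * μ ^ 2)) := by
  refine ⟨fun hC => ?_, fun hC => ?_⟩
  · obtain ⟨hX, hY⟩ := hC.mixing hA₁ hA₂ hp₁ hp₂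
    obtain ⟨γ, h0, h1, h⟩ := CompetingNetworks.exists_perturbedGradientPlay hp₁ hp₂ hX hY
    refine ⟨γ, h0, h1, fun L G σ => ?_⟩
    obtain ⟨μ₀, hμ₀, B, hB⟩ := h L G σ
    -- The bound holds for every threshold, so one `B` serves all `c`.
    refine ⟨μ₀, hμ₀, fun c _ => ⟨B, ?_⟩⟩
    intro M₁ M₂ g hz hL hG μ hμ hμ' Ω _ P _ O hO
    exact hB M₁ M₂ g (Or.inl hz) hL hG μ hμ hμ' Ω P O hO _
  · obtain ⟨hX, hY⟩ := hC.mixing hA₁ hA₂ hp₁ hp₂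
    obtain ⟨γ, h0, h1, h⟩ := CompetingNetworks.exists_perturbedGradientPlay hp₁ hp₂ hX hY
    refine ⟨γ, h0, h1, fun L G σ => ?_⟩
    obtain ⟨μ₀, hμ₀, B, hB⟩ := h L G σ
    refine ⟨μ₀, hμ₀, fun c _ => ⟨B, ?_⟩⟩
    intro M₁ M₂ g hL hG μ hμ hμ' Ω _ P _ O hO
    rw [CompetingNetworks.stepC_eq_stepITC hC.1 hC.2.1] at hO ⊢
    exact hB M₁ M₂ g (Or.inr ⟨hC.1, hC.2.1⟩) hL hG μ hμ hμ' Ω P O hO _
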